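/- **Notation.** Let $N\ge 2$ be an integer and $e(x)=e^{2\pi i x}$. Let $A(m_1,\dots,m_{N-1})\in\mathbb C$ be given for every $(N-1)$-tuple of positive integers, and put $B(m_1,\dots,m_{N-1})=A(m_{N-1},\dots,m_1)$. For a primitive Dirichlet character $\chi^*$ modulo $c^*$ and a multiple $c$ of $c^*$ put $$g(\chi^*,c,m)=\sum_{u \bmod c,\ (u,c)=1}\chi^*(u)\,e(mu/c),\qquad \tau(\chi^*)=g(\chi^*,c^*,1).$$ Let $L(s,F\times\chi^*)=\sum_{n\ge1}A(1,\dots,1,n)\chi^*(n)n^{-s}$ and $L(s,\widetilde F\times\chi^*)=\sum_{n\ge1}B(1,\dots,1,n)\chi^*(n)n^{-s}$. For positive integers $c$, $\vec q=(q_1,\dots,q_{N-2})$ and $\vec d=(d_1,\dots,d_{N-2})$ put $r_i=\frac{q_1\cdots q_i c}{d_1\cdots d_i}$ for $0\le i\le N-2$ (so $r_0=c$). For $b\ge 1$ let $D_b(c,\vec q)$ be the finite set of all $\vec d$ with $d_i b\mid \frac{q_1\cdots q_i c}{d_1\cdots d_{i-1}}$ for $1\le i\le N-2$. For $\vec d\in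 D_1(c,\vec q)$ and integers $a,n$ define $$\mathrm{Kl}(a,n,c;\vec q,\vec d)=\sum_{x_1 \bmod r_1}^{*}\cdots\sum_{x_{N-2} \bmod r_{N-2}}^{*} e\Big(\frac{d_1x_1a}{c}+\sum_{i=2}^{N-2}\frac{d_ix_i\overline{x_{i-1}}}{r_{i-1}}+\frac{n\overline{x_{N-2}}}{r_{N-2}}\Big),$$ where the sums run over reduced residues and $\overline{x_i}$ is the inverse of $x_i$ modulo $r_i$; for $N=2$ this means $e(an/c)$. Put $$W(c,\vec q,\vec d,s)=\frac{1}{c^{Ns-1}d_1\cdots d_{N-2}}\cdot\frac{d_1^{(N-1)s}d_2^{(N-2)s}\cdots d_{N-2}^{2s}}{q_1^{(N-2)s}q_2^{(N-3)s}\cdots q_{N-2}^{s}}.$$ **Theorem.** Assume $A(1,\dots,1)=1$ and the Hecke relations $$A(m_1m_1',\dots,m_{N-1}m_{N-1}')=A(m_1,\dots,m_{N-1})A(m_1',\dots,m_{N-1}')\quad\text{if }(m_1\cdots m_{N-1},m_1'\cdots m_{N-1}')=1,$$ $$A(1,\dots,1,n)A(m_{N-1},\dots,m_1)=\sum A\Big(\frac{m_{N-1}d_{N-2}}{d_{N-1}},\dots,\frac{m_2d_1}{d_2},\frac{m_1d_0}{d_1}\Big),$$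 $$A(n,1,\dots,1)A(m_1,\dots,m_{N-1})=\sum A\Big(\frac{m_1d_0}{d_1},\frac{m_2d_1}{d_2},\dots,\frac{m_{N-1}d_{N-2}}{d_{N-1}}\Big),$$ where both sums run over positive integers with $d_0\cdots d_{N-1}=n$ and $d_1\mid m_1,\dots,d_{N-1}\mid m_{N-1}$. Assume that $A(m_1,\dots,m_{N-1})\ll(m_1\cdots m_{N-1})^\sigma$ for some $\sigma>0$. Let $G_+$ and $G_-$ be meromorphic functions on $\mathbb C$. Assume that for every primitive Dirichlet character $\chi^*$, of any modulus $c^*\ge1$, the series $L(s,F\times\chi^*)$ continues from $\Re(s)>\sigma+1$ to an entire function and that $$L(s,F\times\chi^*)=\tau(\chi^*)^N{c^*}^{-Ns}G(s)\,L(1-s,\widetilde F\times\overline{\chi^*}),$$ where $G=G_+$ if $\chi^*(-1)=1$ and $G=G_-$ if $\chi^*(-1)=-1$. This is an identity of meromorphic functions; it suffices to have it for $\Re(s)<-\sigma$, where the series on the right converges absolutely. Then the following hold for all positive integers $c$ and all tuples $\vec q$ of positive integers. (1) Let $a$ be an integer with $(a,c)=1$ and $a\overline a\equiv1 \pmod c$.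 The series $$L_{\vec q}(s,F,a/c)=\sum_{n\ge1}\frac{A(q_{N-2},\dots,q_1,n)}{n^s}\,e\Big(\frac{\overline a n}{c}\Big)$$ converges absolutely for $\Re(s)>1+\sigma$ and continues to an entire function, and for $\Re(s)<-\sigma$ $$L_{\vec q}(s,F,a/c)=\sum_{\epsilon=\pm1}\frac{G_+(s)-\epsilon\, G_-(s)}2\sum_{\vec d\in D_1(c,\vec q)}W(c,\vec q,\vec d,s)\sum_{n\ge1}\frac{A(n,d_{N-2},\dots,d_1)\,\mathrm{Kl}(a,\epsilon n,c;\vec q,\vec d)}{n^{1-s}},$$ an identity of meromorphic functions in which the series over $n$ converge absolutely. (2) Equivalently, let $\chi^*$ be a primitive character modulo $c^*$ with $c^*\mid c$. The function $$H(\vec q;c,\chi^*,s)=\sum_{n\ge1}\frac{A(q_{N-2},\dots,q_1,n)\,g(\overline{\chi^*},c,n)}{n^s(c/c^*)^{1-2s}},$$ absolutely convergent for $\Re(s)>1+\sigma$, and the function $$G(\vec q;c,\chi^*,s)=\frac{G(s)\chi^*(-1)}{(c/c^*)^{1-2s}}\sum_{\vec d\in D_{c^*}(c,\vec q)}W(c,\vec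 q,\vec d,s)\prod_{i=1}^{N-2}g(\chi^*,r_{i-1},d_i)\sum_{n\ge1}\frac{A(n,d_{N-2},\dots,d_1)\,g(\chi^*,r_{N-2},n)}{n^{1-s}},$$ whose series over $n$ converge absolutely for $\Re(s)<-\sigma$, both continue to entire functions of $s$, and these are equal: $H(\vec q;c,\chi^*,s)=G(\vec q;c,\chi^*,s)$. -/

import Mathlib

/-!
Throughout, the degree of the `L`-functions is `N = k + 2` with `k : ℕ`, so that
coefficients are indexed by `(N-1)`-tuples `Fin (k + 1) → ℕ` and the parameters
`(q_1, …, q_{N-2})`, `(d_1, …, d_{N-2})` are tuples `Fin k → ℕ`. Only tuples of positive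
integers matter: every hypothesis and every conclusion is about those.
Entry `i` of a tuple (counted from `0`) is the entry with index `i + 1` on paper.
-/

namespace Voronoi

noncomputable section

/-- `e(x) = exp(2 π i x)`. -/
def e (x : ℝ) : ℂ := Complex.exp (2 * Real.pi * Complex.I * x)

/-- The tuple `(q_{N-2}, …, q_1, n)`. -/
def endTuple {k : ℕ} (q : Fin k → ℕ) (n : ℕ) : Fin (k + 1) → ℕ :=
  fun i => (Fin.cons n q : Fin (k + 1) → ℕ) i.rev

/-- The tuple `(n, d_{N-2}, …, d_1)`. -/
def startTuple {k : ℕ} (n : ℕ) (d : Fin k → ℕ) : Fin (k + 1) → ℕ :=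
  Fin.cons n (fun i => d i.rev)

/-- The dual coefficients `B(m_1, …, m_{N-1}) = A(m_{N-1}, …, m_1)`. -/
def dual {k : ℕ} (A : (Fin (k + 1) → ℕ) → ℂ) : (Fin (k + 1) → ℕ) → ℂ :=
  fun m => A (fun i => m i.rev)

/-- The tuples `(d_0, …, d_{N-1})` of positive integers with `d_0 ⋯ d_{N-1} = n` and
`d_1 ∣ m_1, …, d_{N-1} ∣ m_{N-1}`. -/
def heckeTuples {k : ℕ} (n : ℕ) (m : Fin (k + 1) → ℕ) : Finset (Fin (k + 2) → ℕ) :=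
  (Nat.finMulAntidiag (k + 2) n).filter fun d => ∀ i : Fin (k + 1), d i.succ ∣ m i

/-- The tuple `(m_1 d_0 / d_1, m_2 d_1 / d_2, …, m_{N-1} d_{N-2} / d_{N-1})`. -/
def heckeShift {k : ℕ} (m : Fin (k + 1) → ℕ) (d : Fin (k + 2) → ℕ) : Fin (k + 1) → ℕ :=
  fun i => m i * d i.castSucc / d i.succ

/-- The Hecke relations on `GL(N)`. -/
structure HeckeRelations {k : ℕ} (A : (Fin (k + 1) → ℕ) → ℂ) : Prop where
  /-- Multiplicativity. -/
  mul : ∀ m m' : Fin (k + 1) → ℕ, (∀ i, 0 < m i) → (∀ i, 0 < m' i) →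
    Nat.Coprime (∏ i, m i) (∏ i, m' i) → A (fun i => m i * m' i) = A m * A m'
  /-- The relation for `A(1, …, 1, n) A(m_{N-1}, …, m_1)`. -/
  mul_end : ∀ (n : ℕ) (m : Fin (k + 1) → ℕ), 0 < n → (∀ i, 0 < m i) →
    A (endTuple (fun _ => 1) n) * A (fun i => m i.rev) =
      ∑ d ∈ heckeTuples n m, A (fun i => heckeShift m d i.rev)
  /-- The relation for `A(n, 1, …, 1) A(m_1, …, m_{N-1})`. -/
  mul_start : ∀ (n : ℕ) (m : Fin (k + 1) → ℕ), 0 < n → (∀ i, 0 < m i) →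
    A (startTuple n (fun _ => 1)) * A m = ∑ d ∈ heckeTuples n m, A (heckeShift m d)

/-- Moderate growth with exponent `σ`: `A(m_1, …, m_{N-1}) ≪ (m_1 ⋯ m_{N-1})^σ`. -/
def ModerateGrowth {k : ℕ} (A : (Fin (k + 1) → ℕ) → ℂ) (σ : ℝ) : Prop :=
  ∃ C : ℝ, ∀ m : Fin (k + 1) → ℕ, (∀ i, 0 < m i) →
    ‖A m‖ ≤ C * ((∏ i, m i : ℕ) : ℝ) ^ σ

/-- The Gauss sum `g(χ*, c, m) = ∑ χ(u) e(mu/c)` over the reduced residues `u` modulo `c`,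
where `χ` is the character modulo `c` induced from the character `χ*` modulo `c* ∣ c`:
for `u` coprime to `c`, `χ(u) = χ*(u)`. -/
def gauss {cstar : ℕ} (χ : DirichletCharacter ℂ cstar) (c : ℕ) (m : ℤ) : ℂ :=
  ∑ u ∈ (Finset.range c).filter (fun u => u.Coprime c),
    χ (u : ZMod cstar) * e ((m : ℝ) * (u : ℝ) / (c : ℝ))

/-- `G = G_+` or `G = G_-` according to whether `χ(-1)` is `1` or `-1`. -/
def signFactor {cstar : ℕ} (Gp Gm : ℂ → ℂ) (χ : DirichletCharacter ℂ cstar) : ℂ → ℂ :=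
  open Classical in if χ (-1) = 1 then Gp else Gm

/-- The Dirichlet coefficients `A(1, …, 1, n) χ(n)` of `L(s, F × χ)`. -/
def twistedCoeff {k cstar : ℕ} (A : (Fin (k + 1) → ℕ) → ℂ)
    (χ : DirichletCharacter ℂ cstar) (n : ℕ) : ℂ :=
  A (endTuple (fun _ => 1) n) * χ (n : ZMod cstar)

/-- For every primitive `χ` modulo `c`, the series `L(s, F × χ)` continues from
`Re s > σ + 1` to an entire function `Λ`, and
`Λ(s) = τ(χ)^N c^{-Ns} G(s) L(1 - s, F~ × χ̄)`.
The functional equation is an identity of meromorphic functions; it is imposed where both sides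
are given by their definitions, that is at the points of the half-plane `Re s < -σ` (where
`L(1 - s, F~ × χ̄)` is an absolutely convergent series) at which the function `G` is analytic. -/
def TwistedFunctionalEquations {k : ℕ} (A : (Fin (k + 1) → ℕ) → ℂ) (Gp Gm : ℂ → ℂ)
    (σ : ℝ) : Prop :=
  ∀ (c : ℕ) (χ : DirichletCharacter ℂ c), 0 < c → χ.IsPrimitive →
    ∃ Λ : ℂ → ℂ, Differentiable ℂ Λ ∧
      (∀ s : ℂ, σ + 1 < s.re → Λ s = LSeries (twistedCoeff A χ) s) ∧
      (∀ s : ℂ, s.re < -σ → AnalyticAt ℂ (signFactor Gp Gm χ) s →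
        Λ s = gauss χ c 1 ^ (k + 2) * (c : ℂ) ^ (-((k + 2 : ℕ) * s)) * signFactor Gp Gm χ s *
          LSeries (twistedCoeff (dual A) χ⁻¹) (1 - s))

/-- The integer `q_1 ⋯ q_i c / (d_1 ⋯ d_i)` for `0 ≤ i ≤ N - 2`. -/
def level {k : ℕ} (c : ℕ) (q d : Fin k → ℕ) (i : Fin (k + 1)) : ℕ :=
  ((∏ j with j.castSucc < i, q j) * c) / ∏ j with j.castSucc < i, d j

/-- The tuples `(d_1, …, d_{N-2})` of positive integers with
`d_i b ∣ q_1 ⋯ q_i c / (d_1 ⋯ d_{i-1})` for `1 ≤ i ≤ N - 2`. (All these `d_i` divide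
`q_1 ⋯ q_{N-2} c`, so the range from which the tuples are taken is no restriction.) -/
def divTuples {k : ℕ} (b c : ℕ) (q : Fin k → ℕ) : Finset (Fin k → ℕ) :=
  (Fintype.piFinset fun _ : Fin k => ((∏ j, q j) * c).divisors).filter fun d =>
    ∀ i : Fin k, d i * b ∣ q i * level c q d i.castSucc

/-- The hyper-Kloosterman sum `Kl(a, n, c; q, d)`: the sum over reduced residues `x_i` modulo
`r_i = q_1 ⋯ q_i c / (d_1 ⋯ d_i)`, for `1 ≤ i ≤ N - 2`, of
`e(d_1 x_1 a / c + ∑_{i ≥ 2} d_i x_i y_{i-1} / r_{i-1} + n y_{N-2} / r_{N-2})`, where `y_i` is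
inverse to `x_i` modulo `r_i`. In the code `y_0 = a`. For `N = 2` this is `e(an/c)`. -/
def hyperKloosterman {k : ℕ} (a n : ℤ) (c : ℕ) (q d : Fin k → ℕ) : ℂ :=
  ∑ x ∈ Fintype.piFinset fun i : Fin k =>
      (Finset.range (level c q d i.succ)).filter fun u => u.Coprime (level c q d i.succ),
    let y : Fin (k + 1) → ℤ :=
      Fin.cons a fun i => (((x i : ZMod (level c q d i.succ))⁻¹).val : ℤ)
    e ((∑ i : Fin k, (d i : ℝ) * (x i : ℝ) * (y i.castSucc : ℝ) /
          (level c q d i.castSucc : ℝ)) +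
        (n : ℝ) * (y (Fin.last k) : ℝ) / (level c q d (Fin.last k) : ℝ))

/-- The factor
`d_1^{(N-1)s} ⋯ d_{N-2}^{2s} / (c^{Ns-1} d_1 ⋯ d_{N-2} q_1^{(N-2)s} ⋯ q_{N-2}^s)`. -/
def weight {k : ℕ} (c : ℕ) (q d : Fin k → ℕ) (s : ℂ) : ℂ :=
  (∏ i : Fin k, (d i : ℂ) ^ (((k + 1 - i.val : ℕ) : ℂ) * s)) /
    ((c : ℂ) ^ ((k + 2 : ℕ) * s - 1) * (∏ i : Fin k, (d i : ℂ)) *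
      ∏ i : Fin k, (q i : ℂ) ^ (((k - i.val : ℕ) : ℂ) * s))

/-- The Dirichlet coefficients `A(q_{N-2}, …, q_1, n) e(ā n / c)` of `L_q(s, F, a/c)`, where
`abar = ā`. -/
def additiveCoeff {k : ℕ} (A : (Fin (k + 1) → ℕ) → ℂ) (q : Fin k → ℕ) (c : ℕ) (abar : ℤ)
    (n : ℕ) : ℂ :=
  A (endTuple q n) * e ((abar : ℝ) * (n : ℝ) / (c : ℝ))

/-- The coefficients `A(n, d_{N-2}, …, d_1) Kl(a, ε n, c; q, d)`; here `ε = 1` or `ε = -1`. -/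
def kloostermanCoeff {k : ℕ} (A : (Fin (k + 1) → ℕ) → ℂ) (a ε : ℤ) (c : ℕ)
    (q d : Fin k → ℕ) (n : ℕ) : ℂ :=
  A (startTuple n d) * hyperKloosterman a (ε * n) c q d

/-- The right side of the Voronoi formula for `L_q(s, F, a/c)`. -/
def voronoiRHS {k : ℕ} (A : (Fin (k + 1) → ℕ) → ℂ) (Gp Gm : ℂ → ℂ) (a : ℤ) (c : ℕ)
    (q : Fin k → ℕ) (s : ℂ) : ℂ :=
  (Gp s - Gm s) / 2 * ∑ d ∈ divTuples 1 c q,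
      LSeries (kloostermanCoeff A a 1 c q d) (1 - s) * weight c q d s +
  (Gp s + Gm s) / 2 * ∑ d ∈ divTuples 1 c q,
      LSeries (kloostermanCoeff A a (-1) c q d) (1 - s) * weight c q d s

/-- The coefficients `A(q_{N-2}, …, q_1, n) g(χ̄*, c, n)`. -/
def hCoeff {k cstar : ℕ} (A : (Fin (k + 1) → ℕ) → ℂ) (q : Fin k → ℕ) (c : ℕ)
    (χ : DirichletCharacter ℂ cstar) (n : ℕ) : ℂ :=
  A (endTuple q n) * gauss χ⁻¹ c n

/-- The series `H(q; c, χ*, s)`. -/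
def hSeries {k cstar : ℕ} (A : (Fin (k + 1) → ℕ) → ℂ) (q : Fin k → ℕ) (c : ℕ)
    (χ : DirichletCharacter ℂ cstar) (s : ℂ) : ℂ :=
  LSeries (hCoeff A q c χ) s / ((c : ℂ) / (cstar : ℂ)) ^ (1 - 2 * s)

/-- The coefficients `A(n, d_{N-2}, …, d_1) g(χ*, q_1 ⋯ q_{N-2} c / (d_1 ⋯ d_{N-2}), n)`. -/
def gCoeff {k cstar : ℕ} (A : (Fin (k + 1) → ℕ) → ℂ) (q d : Fin k → ℕ) (c : ℕ)
    (χ : DirichletCharacter ℂ cstar) (n : ℕ) : ℂ :=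
  A (startTuple n d) * gauss χ (level c q d (Fin.last k)) n

/-- The expression `G(q; c, χ*, s)`. -/
def gSeries {k cstar : ℕ} (A : (Fin (k + 1) → ℕ) → ℂ) (Gp Gm : ℂ → ℂ) (q : Fin k → ℕ)
    (c : ℕ) (χ : DirichletCharacter ℂ cstar) (s : ℂ) : ℂ :=
  signFactor Gp Gm χ s * χ (-1) / ((c : ℂ) / (cstar : ℂ)) ^ (1 - 2 * s) *
    ∑ d ∈ divTuples cstar c q,
      LSeries (gCoeff A q d c χ) (1 - s) * weight c q d s *
        ∏ i : Fin k, gauss χ (level c q d i.castSucc) (d i)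

end

end Voronoi

/-!
Write `Y(n) = χ(n) n^{-s}` for a primitive character `χ` modulo `b`, let `c = b l`, and let `B` be
the coefficients `A` with the order of the arguments reversed, so that `A(q_{N-2}, …, q₁, n)` is
`B(n, q₁, …, q_{N-2})`. The whole theorem reduces to finite identities.

*The formula with Gauss sums.* The Gauss sum `g(χ̄, b l, n)` is `τ(χ̄)` times a divisor sum over
`l` (`gauss_mul_eq`), so `H` is a finite combination of the series `∑ B(f n, q) Y(n)` with `f ∣ l`.
Summing the Hecke relation for `A(1, …, 1, n) A(m_{N-1}, …, m₁)` against `Y(n)` writes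
`L(s, F × χ) B(m)` as a finite combination `heckeSum` of such series (`LSeries_mul_dual`). The
operator `heckeSum` is a composition of one-variable Dirichlet convolutions with `Y`, one for each
divisor `dᵢ ∣ mᵢ`, so Möbius inversion in each variable, taken in the reverse order, gives an
explicit inverse `chainSum` (`chainSum_heckeSum`). Thus `∑ B(f n, q) Y(n)` is `L(s, F × χ)` times a
Dirichlet polynomial `chainFactor` (`headSeries_cons`), and `H` is entire.

On the other side the weight `W` is a product of powers of the levels `rᵢ` and of the `dᵢ`
(`weight_eq`), and expanding every Gauss sum turns the sum over `d` into the sum `splitSum`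
(`sum_divTuples_gauss`). Summing the other Hecke relation against `χ̄(n) n^{s-1}` expresses
`L(1 - s, F~ × χ̄) B(m)` (`LSeries_dual_mul_dual`), and inserting this into `chainFactor` produces,
after interchanging divisors, again the sum `splitSum` (`sum_splitSum`). So both sides of the
Voronoi formula are the same finite factor times the two sides of the functional equation of
`L(s, F × χ)`; the constants agree because `τ(χ) τ(χ̄) = χ(-1) b`.

*The formula with additive twists* is the Fourier transform of the former over all characters
modulo `c`. The transform of a hyper-Kloosterman sum is a product of Gauss sums, and it vanishes
unless the conductor divides all the levels (`sum_char_mul_hyperKloosterman`).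
-/

namespace Voronoi

open Finset

/-! ### Additive characters and Gauss sums -/

lemma e_intCast_div (c : ℕ) [NeZero c] (m : ℤ) :
    e ((m : ℝ) / (c : ℝ)) = ZMod.stdAddChar (m : ZMod c) := by
  rw [ZMod.stdAddChar_coe, e]
  push_cast
  congr 1
  ring

lemma e_add (x y : ℝ) : e (x + y) = e x * e y := by
  rw [e, e, e, ← Complex.exp_add]
  push_cast
  congr 1
  ring

lemma sum_range_eq_sum_zmod {M : Type*} [AddCommMonoid M] (c : ℕ) [NeZero c] (f : ℕ → M) :
    ∑ u ∈ range c, f u = ∑ x : ZMod c, f x.val := by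
  refine sum_nbij' (fun u => (u : ZMod c)) (fun x => x.val) ?_ ?_ ?_ ?_ ?_
  · simp
  · intro x _
    simpa using ZMod.val_lt x
  · intro u hu
    exact ZMod.val_cast_of_lt (by simpa using hu)
  · simp
  · intro u hu
    rw [ZMod.val_cast_of_lt (by simpa using hu)]

lemma sum_coprime_eq_sum_units {M : Type*} [AddCommMonoid M] (c : ℕ) [NeZero c] (f : ℕ → M) :
    ∑ u ∈ range c with u.Coprime c, f u = ∑ x : (ZMod c)ˣ, f (x : ZMod c).val := by
  refine sum_bij' (fun u hu => ZMod.unitOfCoprime u (mem_filter.1 hu).2)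
    (fun x _ => (x : ZMod c).val) ?_ ?_ ?_ ?_ ?_
  · simp
  · intro x _
    simpa using ⟨ZMod.val_lt _, ZMod.val_coe_unit_coprime x⟩
  · intro u hu
    simp only [mem_filter, mem_range] at hu
    simp [ZMod.coe_unitOfCoprime, ZMod.val_cast_of_lt hu.1]
  · intro x _
    ext
    simp [ZMod.coe_unitOfCoprime]
  · intro u hu
    simp only [mem_filter, mem_range] at hu
    simp [ZMod.coe_unitOfCoprime, ZMod.val_cast_of_lt hu.1]

lemma sum_range_mul {M : Type*} [AddCommMonoid M] (c d : ℕ) (f : ℕ → M) :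
    ∑ v ∈ range (c * d), f v = ∑ j ∈ range d, ∑ v ∈ range c, f (v + c * j) := by
  induction d with
  | zero => simp
  | succ d ih =>
    rw [Nat.mul_succ, sum_range_add, ih, sum_range_succ]
    simp [add_comm]

lemma sum_range_dvd {M : Type*} [AddCommMonoid M] (δ d : ℕ) (hδ : 0 < δ) (f : ℕ → M) :
    ∑ u ∈ range (δ * d) with δ ∣ u, f u = ∑ v ∈ range d, f (δ * v) := by
  symm
  refine sum_nbij' (fun v => δ * v) (fun u => u / δ) ?_ ?_ ?_ ?_ ?_
  · intro v hv
    simp only [mem_range, mem_filter] at hv ⊢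
    exact ⟨Nat.mul_lt_mul_of_pos_left hv hδ, dvd_mul_right _ _⟩
  · intro u hu
    simp only [mem_range, mem_filter] at hu ⊢
    exact Nat.div_lt_of_lt_mul hu.1
  · intro v _
    exact Nat.mul_div_cancel_left v hδ
  · intro u hu
    exact Nat.mul_div_cancel' (mem_filter.1 hu).2
  · simp

/-- The value of an induced character at a unit. -/
lemma changeLevel_apply_unit {b c : ℕ} [NeZero c] (χ : DirichletCharacter ℂ b) (h : b ∣ c)
    (x : (ZMod c)ˣ) :
    DirichletCharacter.changeLevel h χ x = χ ((x : ZMod c).val : ZMod b) := by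
  rw [DirichletCharacter.changeLevel_eq_cast_of_dvd, ZMod.cast_eq_val]

/-- Sums over reduced residues weighted by a character, as sums over all residues. -/
lemma sum_changeLevel {b c : ℕ} [NeZero c] (χ : DirichletCharacter ℂ b) (h : b ∣ c)
    (f : ZMod c → ℂ) :
    ∑ u ∈ range c with u.Coprime c, χ (u : ZMod b) * f u =
      ∑ x : ZMod c, DirichletCharacter.changeLevel h χ x * f x := by
  rw [sum_coprime_eq_sum_units c (fun u => χ (u : ZMod b) * f u)]
  simp_rw [← changeLevel_apply_unit χ h, ZMod.natCast_zmod_val]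
  refine Finset.sum_of_injOn (fun x : (ZMod c)ˣ => (x : ZMod c)) ?_ ?_ ?_ ?_
  · exact Units.val_injective.injOn
  · simp
  · intro x _ hx
    rw [MulChar.map_nonunit, zero_mul]
    rintro ⟨u, rfl⟩
    exact hx ⟨u, by simp⟩
  · simp

lemma gauss_eq_gaussSum {b c : ℕ} [NeZero c] (χ : DirichletCharacter ℂ b) (h : b ∣ c) (m : ℤ) :
    gauss χ c m =
      gaussSum (DirichletCharacter.changeLevel h χ) (ZMod.stdAddChar.mulShift (m : ZMod c)) := by
  rw [gauss, gaussSum]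
  simp_rw [AddChar.mulShift_apply]
  rw [← sum_changeLevel χ h (fun x => ZMod.stdAddChar ((m : ZMod c) * x))]
  refine sum_congr rfl fun u _ => ?_
  rw [← Int.cast_natCast (R := ZMod c) u, ← Int.cast_mul, ← e_intCast_div]
  push_cast
  rfl

lemma gauss_mul_unit {b c : ℕ} [NeZero c] (χ : DirichletCharacter ℂ b) (h : b ∣ c) (m : ℤ)
    (u : (ZMod c)ˣ) (n : ℤ) (hn : (n : ZMod c) = m * u) :
    gauss χ c n = χ⁻¹ ((u : ZMod c).val : ZMod b) * gauss χ c m := by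
  rw [gauss_eq_gaussSum χ h, gauss_eq_gaussSum χ h, hn]
  have := gaussSum_mulShift_eq (DirichletCharacter.changeLevel h χ)
    (ZMod.stdAddChar.mulShift (m : ZMod c)) u
  rw [AddChar.mulShift_mulShift] at this
  rw [this, ← changeLevel_apply_unit χ⁻¹ h, map_inv]

/-- `τ(χ̄) τ(χ) = χ(-1) c`. -/
lemma gauss_inv_mul_gauss {c : ℕ} [NeZero c] {χ : DirichletCharacter ℂ c} (hχ : χ.IsPrimitive) :
    gauss χ⁻¹ c 1 * gauss χ c 1 = χ (-1) * c := by
  have h1 : ∀ a : ZMod c, χ⁻¹ a * gauss χ c 1 =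
      ∑ x : ZMod c, χ x * ZMod.stdAddChar (a * x) := by
    intro a
    rw [gauss_eq_gaussSum χ dvd_rfl, DirichletCharacter.changeLevel_self]
    simp only [Int.cast_one, AddChar.mulShift_one]
    rw [← gaussSum_mulShift_of_isPrimitive _ hχ, gaussSum]
    simp [AddChar.mulShift_apply]
  have h2 : gauss χ⁻¹ c 1 = ∑ a : ZMod c, χ⁻¹ a * ZMod.stdAddChar a := by
    rw [gauss_eq_gaussSum χ⁻¹ dvd_rfl, DirichletCharacter.changeLevel_self, gaussSum]
    simp
  rw [h2, sum_mul]
  calc ∑ a : ZMod c, χ⁻¹ a * ZMod.stdAddChar a * gauss χ c 1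
      = ∑ a : ZMod c, ∑ x : ZMod c, χ x * ZMod.stdAddChar (a * (x + 1)) := by
        refine sum_congr rfl fun a _ => ?_
        rw [mul_right_comm, h1, sum_mul]
        refine sum_congr rfl fun x _ => ?_
        rw [mul_add, AddChar.map_add_eq_mul, mul_one, mul_assoc]
    _ = ∑ x : ZMod c, χ x * ∑ a : ZMod c, ZMod.stdAddChar (a * (x + 1)) := by
        rw [sum_comm]
        simp_rw [mul_sum]
    _ = χ (-1) * c := by
        simp_rw [AddChar.sum_mulShift _ (ZMod.isPrimitive_stdAddChar c)]
        rw [sum_eq_single (-1)]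
        · simp
        · intro x _ hx
          rw [if_neg (fun h => hx (eq_neg_of_add_eq_zero_left h)), Nat.cast_zero, mul_zero]
        · simp

lemma isPrimitive_inv {c : ℕ} {χ : DirichletCharacter ℂ c} (hχ : χ.IsPrimitive) :
    χ⁻¹.IsPrimitive := by
  rw [DirichletCharacter.isPrimitive_def, DirichletCharacter.conductor_inv]
  exact hχ

/-- A sum over all residues modulo `c d` of a character modulo `c` against an additive character:
it vanishes unless `d` divides the frequency. -/
lemma sum_range_char_mul_e {c d : ℕ} [NeZero c] [NeZero d] {χ : DirichletCharacter ℂ c}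
    (hχ : χ.IsPrimitive) (m : ℕ) :
    ∑ v ∈ range (c * d), χ (v : ZMod c) * e ((m : ℝ) * v / ((c * d : ℕ) : ℝ)) =
      if d ∣ m then d * χ⁻¹ ((m / d : ℕ) : ZMod c) * gauss χ c 1 else 0 := by
  have hc : (c : ℝ) ≠ 0 := by exact_mod_cast NeZero.ne c
  have hd : (d : ℝ) ≠ 0 := by exact_mod_cast NeZero.ne d
  rw [sum_range_mul]
  have h1 : ∀ j ∈ range d, ∀ v ∈ range c,
      χ ((v + c * j : ℕ) : ZMod c) * e ((m : ℝ) * (v + c * j : ℕ) / ((c * d : ℕ) : ℝ)) =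
      e ((m : ℝ) * j / d) * (χ (v : ZMod c) * e ((m : ℝ) * v / ((c * d : ℕ) : ℝ))) := by
    intro j _ v _
    have : (m : ℝ) * (v + c * j : ℕ) / ((c * d : ℕ) : ℝ) =
        (m : ℝ) * j / d + (m : ℝ) * v / ((c * d : ℕ) : ℝ) := by
      push_cast
      field_simp
      ring
    rw [this, e_add]
    simp
    ring
  rw [sum_congr rfl fun j hj => sum_congr rfl (h1 j hj)]
  simp_rw [← mul_sum]
  rw [← sum_mul]
  have h2 : ∑ j ∈ range d, e ((m : ℝ) * j / d) = if d ∣ m then (d : ℂ) else 0 := by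
    rw [sum_range_eq_sum_zmod]
    have : ∀ x : ZMod d, e ((m : ℝ) * x.val / d) = ZMod.stdAddChar (x * (m : ZMod d)) := by
      intro x
      have := e_intCast_div d ((m * x.val : ℕ) : ℤ)
      push_cast at this
      rw [this, ZMod.natCast_zmod_val, mul_comm]
    simp_rw [this, AddChar.sum_mulShift _ (ZMod.isPrimitive_stdAddChar d),
      ZMod.natCast_eq_zero_iff, ZMod.card]
    split_ifs <;> simp
  rw [h2]
  split_ifs with hdm
  · rw [mul_assoc]
    congr 1
    obtain ⟨n, rfl⟩ := hdm
    rw [Nat.mul_div_cancel_left _ (NeZero.pos d), sum_range_eq_sum_zmod,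
      gauss_eq_gaussSum χ dvd_rfl, DirichletCharacter.changeLevel_self, Int.cast_one,
      AddChar.mulShift_one, ← gaussSum_mulShift_of_isPrimitive _ hχ, gaussSum]
    refine sum_congr rfl fun x _ => ?_
    rw [ZMod.natCast_zmod_val, AddChar.mulShift_apply]
    have := e_intCast_div c ((n * x.val : ℕ) : ℤ)
    push_cast at this
    rw [ZMod.natCast_zmod_val] at this
    rw [← this]
    congr 2
    push_cast
    field_simp
  · simp

/-- Gauss sums to a modulus `c l` in terms of the Gauss sum of the primitive character. -/
lemma gauss_mul_eq {c l : ℕ} [NeZero c] (hl : 0 < l) {χ : DirichletCharacter ℂ c}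
    (hχ : χ.IsPrimitive) (m : ℕ) :
    gauss χ (c * l) m = gauss χ c 1 * ∑ p ∈ l.divisorsAntidiagonal,
      if p.2 ∣ m then (ArithmeticFunction.moebius p.1 : ℂ) * χ (p.1 : ZMod c) *
        (p.2 * χ⁻¹ ((m / p.2 : ℕ) : ZMod c)) else 0 := by
  classical
  -- The condition `(u, l) = 1` is detected by the Möbius function; coprimality to `c` is free,
  -- since `χ` vanishes elsewhere.
  have hmu : ∀ u : ℕ, (if Nat.Coprime u l then (1 : ℂ) else 0) =
      ∑ δ ∈ l.divisors with δ ∣ u, (ArithmeticFunction.moebius δ : ℂ) := by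
    intro u
    have hg : u.gcd l ≠ 0 := Nat.gcd_ne_zero_right hl.ne'
    have hs : ({δ ∈ l.divisors | δ ∣ u} : Finset ℕ) = (u.gcd l).divisors := by
      ext δ
      simp [Nat.dvd_gcd_iff, hl.ne', and_comm]
    rw [hs]
    have := congrArg (fun f => f (u.gcd l))
      (ArithmeticFunction.coe_zeta_mul_coe_moebius (R := ℂ))
    simp only [ArithmeticFunction.coe_zeta_mul_apply, ArithmeticFunction.one_apply] at this
    simpa [Nat.Coprime] using this.symm
  have h1 : gauss χ (c * l) m = ∑ u ∈ range (c * l), ∑ δ ∈ l.divisors with δ ∣ u,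
      (ArithmeticFunction.moebius δ : ℂ) *
        (χ (u : ZMod c) * e ((m : ℝ) * u / ((c * l : ℕ) : ℝ))) := by
    rw [gauss, sum_filter]
    refine sum_congr rfl fun u _ => ?_
    rw [← sum_mul, ← hmu]
    by_cases huc : u.Coprime c
    · have : u.Coprime (c * l) ↔ u.Coprime l := by
        rw [Nat.coprime_mul_iff_right, and_iff_right huc]
      simp [this]
    · have : χ (u : ZMod c) = 0 :=
        MulChar.map_nonunit _ (fun h => huc ((ZMod.isUnit_iff_coprime _ _).1 h))
      simp [this]
  rw [h1]
  simp_rw [sum_filter]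
  rw [sum_comm, ← Nat.sum_divisorsAntidiagonal (f := fun δ _ => ∑ u ∈ range (c * l),
    if δ ∣ u then (ArithmeticFunction.moebius δ : ℂ) *
        (χ (u : ZMod c) * e ((m : ℝ) * u / ((c * l : ℕ) : ℝ))) else 0), mul_sum]
  refine sum_congr rfl fun p hp => ?_
  obtain ⟨rfl, -⟩ := Nat.mem_divisorsAntidiagonal.1 hp
  have hp1 : 0 < p.1 := Nat.pos_of_mul_pos_right hl
  have hp2 : 0 < p.2 := Nat.pos_of_mul_pos_left hl
  have : NeZero p.2 := ⟨hp2.ne'⟩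
  rw [← sum_filter, mul_left_comm, sum_range_dvd _ _ hp1]
  have h3 : ∀ v ∈ range (c * p.2), (ArithmeticFunction.moebius p.1 : ℂ) *
      (χ ((p.1 * v : ℕ) : ZMod c) *
        e ((m : ℝ) * (p.1 * v : ℕ) / ((p.1 * (c * p.2) : ℕ) : ℝ))) =
      (ArithmeticFunction.moebius p.1 : ℂ) * χ (p.1 : ZMod c) *
        (χ (v : ZMod c) * e ((m : ℝ) * v / ((c * p.2 : ℕ) : ℝ))) := by
    intro v _
    have hp1' : (p.1 : ℝ) ≠ 0 := by exact_mod_cast hp1.ne'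
    have hp2' : (p.2 : ℝ) ≠ 0 := by exact_mod_cast hp2.ne'
    have hc : (c : ℝ) ≠ 0 := by exact_mod_cast NeZero.ne c
    have : (m : ℝ) * (p.1 * v : ℕ) / ((p.1 * (c * p.2) : ℕ) : ℝ) =
        (m : ℝ) * v / ((c * p.2 : ℕ) : ℝ) := by
      push_cast
      field_simp
    rw [this]
    push_cast
    rw [map_mul]
    ring
  rw [sum_congr rfl h3, ← mul_sum, sum_range_char_mul_e hχ]
  split_ifs <;> ring

/-! ### Sums over chains of divisors -/

lemma sum_divisorsAntidiagonal_assoc {M : Type*} [AddCommMonoid M] (n : ℕ) (f : ℕ → ℕ → ℕ → M) :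
    ∑ p ∈ n.divisorsAntidiagonal, ∑ r ∈ p.2.divisorsAntidiagonal, f p.1 r.1 r.2 =
      ∑ p ∈ n.divisorsAntidiagonal, ∑ r ∈ p.1.divisorsAntidiagonal, f r.1 r.2 p.2 := by
  rw [sum_sigma', sum_sigma']
  refine sum_nbij' (fun x => ⟨(x.1.1 * x.2.1, x.2.2), (x.1.1, x.2.1)⟩)
    (fun x => ⟨(x.2.1, x.2.2 * x.1.2), (x.2.2, x.1.2)⟩) ?_ ?_ ?_ ?_ ?_
  all_goals
    rintro ⟨⟨a, b⟩, ⟨x, y⟩⟩ h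
    simp only [mem_sigma, Nat.mem_divisorsAntidiagonal] at h ⊢
  · obtain ⟨⟨rfl, h1⟩, rfl, h2⟩ := h
    simp_all [mul_assoc]
  · obtain ⟨⟨rfl, h1⟩, rfl, h2⟩ := h
    simp_all [mul_assoc]
  · obtain ⟨⟨rfl, h1⟩, rfl, h2⟩ := h
    rfl
  · obtain ⟨⟨rfl, h1⟩, rfl, h2⟩ := h
    rfl

lemma sum_divisorsAntidiagonal_left_comm {M : Type*} [AddCommMonoid M] (n : ℕ)
    (f : ℕ → ℕ → ℕ → M) :
    ∑ p ∈ n.divisorsAntidiagonal, ∑ r ∈ p.2.divisorsAntidiagonal, f p.1 r.1 r.2 =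
      ∑ p ∈ n.divisorsAntidiagonal, ∑ r ∈ p.2.divisorsAntidiagonal, f r.1 p.1 r.2 := by
  rw [sum_divisorsAntidiagonal_assoc, sum_divisorsAntidiagonal_assoc n fun a b c => f b a c]
  refine sum_congr rfl fun p _ => ?_
  conv_lhs => rw [← Nat.map_swap_divisorsAntidiagonal, sum_map]
  rfl

/-- Multiply the first entry of a tuple by `t`. -/
def mulHead {n : ℕ} (t : ℕ) (m : Fin n → ℕ) : Fin n → ℕ :=
  fun i => if i.val = 0 then t * m i else m i

@[simp] lemma mulHead_one {n : ℕ} (m : Fin n → ℕ) : mulHead 1 m = m := by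
  funext i
  simp [mulHead]

lemma mulHead_succ {n : ℕ} (t : ℕ) (m : Fin (n + 1) → ℕ) :
    mulHead t m = Fin.cons (t * m 0) (Fin.tail m) := by
  funext i
  cases i using Fin.cases <;> simp [mulHead, Fin.tail]

/-- The sum of `w e₁ ⋯ w eₙ B(t m₁ / e₁, e₁ m₂ / e₂, …, eₙ₋₁ mₙ / eₙ)` over the chains
`e₁ ∣ t m₁, e₂ ∣ e₁ m₂, …, eₙ ∣ eₙ₋₁ mₙ`. For `w = μ Y` with `Y` completely multiplicative and
`t = 1` this operator is inverse to `heckeSum`. -/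
def chainSum (w : ℕ → ℂ) : (n : ℕ) → ((Fin n → ℕ) → ℂ) → ℕ → (Fin n → ℕ) → ℂ
  | 0, B, _, m => B m
  | n + 1, B, t, m => ∑ p ∈ (t * m 0).divisorsAntidiagonal,
      w p.1 * chainSum w n (fun m' => B (Fin.cons p.2 m')) p.1 (Fin.tail m)

/-- The sum of `Y d₁ ⋯ Y dₙ D(t m₁ / d₁, d₁ m₂ / d₂, …, dₙ₋₁ mₙ / dₙ)` over the independent
divisors `d₁ ∣ m₁, …, dₙ ∣ mₙ`. -/
def heckeSum (Y : ℕ → ℂ) : (n : ℕ) → ((Fin n → ℕ) → ℂ) → ℕ → (Fin n → ℕ) → ℂ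
  | 0, D, _, m => D m
  | n + 1, D, t, m => ∑ p ∈ (m 0).divisorsAntidiagonal,
      Y p.1 * heckeSum Y n (fun m' => D (Fin.cons (t * p.2) m')) p.1 (Fin.tail m)

/-- The sum of `Y h₁ ⋯ Y hₙ D(u h₁, m₁ h₂ / h₁, …, mₙ₋₁ hₙ / hₙ₋₁, mₙ / hₙ)` over the
independent divisors `h₁ ∣ m₁, …, hₙ ∣ mₙ`. -/
def dualHeckeSum (Y : ℕ → ℂ) :
    (n : ℕ) → ((Fin (n + 1) → ℕ) → ℂ) → ℕ → (Fin n → ℕ) → ℂ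
  | 0, D, u, _ => D fun _ => u
  | n + 1, D, u, m => ∑ p ∈ (m 0).divisorsAntidiagonal,
      Y p.1 * dualHeckeSum Y n (fun m' => D (Fin.cons (u * p.1) m')) p.2 (Fin.tail m)

/-- The combinatorial core of the right side of the Voronoi formula: the sum over the chains of
divisors `d₁ ∣ q₁ l, d₂ ∣ q₂ (q₁ l / d₁), …` in which every `dᵢ = fᵢ hᵢ` is split according to the
divisor sum that evaluates a Gauss sum to a modulus that is `eᵢ fᵢ` times the conductor. -/
def splitSum (w Y : ℕ → ℂ) :
    (n : ℕ) → ((Fin (n + 1) → ℕ) → ℂ) → ℕ → (Fin n → ℕ) → ℂ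
  | 0, D, l, _ => ∑ p ∈ l.divisorsAntidiagonal, w p.1 * D fun _ => p.2
  | n + 1, D, l, q => ∑ p ∈ l.divisorsAntidiagonal, w p.1 *
      ∑ r ∈ (q 0 * p.1).divisorsAntidiagonal,
        Y r.1 * splitSum w Y n (fun m' => D (Fin.cons (p.2 * r.1) m')) r.2 (Fin.tail q)

lemma chainSum_sum (w : ℕ → ℂ) {ι : Type*} (s : Finset ι) (a : ι → ℂ) (n : ℕ)
    (B : ι → (Fin n → ℕ) → ℂ) (t : ℕ) (m : Fin n → ℕ) :
    chainSum w n (fun m' => ∑ i ∈ s, a i * B i m') t m =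
      ∑ i ∈ s, a i * chainSum w n (B i) t m := by
  induction n generalizing t with
  | zero => rfl
  | succ n ih =>
    simp only [chainSum, ih, mul_sum]
    rw [sum_comm]
    refine sum_congr rfl fun i _ => sum_congr rfl fun p _ => ?_
    ring

lemma chainSum_const_mul (w : ℕ → ℂ) (a : ℂ) (n : ℕ)
    (B : (Fin n → ℕ) → ℂ) (t : ℕ) (m : Fin n → ℕ) :
    chainSum w n (fun m' => a * B m') t m = a * chainSum w n B t m := by
  simpa using chainSum_sum w {()} (fun _ => a) n (fun _ => B) t m

lemma chainSum_congr (w : ℕ → ℂ) (n : ℕ) {B B' : (Fin n → ℕ) → ℂ}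
    (h : ∀ m, (∀ i, 0 < m i) → B m = B' m) (t : ℕ) (m : Fin n → ℕ) (hm : ∀ i, 0 < m i) :
    chainSum w n B t m = chainSum w n B' t m := by
  induction n generalizing t with
  | zero => exact h m hm
  | succ n ih =>
    simp only [chainSum]
    refine sum_congr rfl fun p hp => ?_
    congr 1
    refine ih (fun m' hm' => h _ ?_) _ _ (fun i => hm i.succ)
    intro i
    have := Nat.ne_zero_of_mem_divisorsAntidiagonal hp
    cases i using Fin.cases
    · simpa using Nat.pos_of_ne_zero this.2
    · simpa using hm' _

/-- A sum over pairs against the convolution inverse of a completely multiplicative weight. -/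
lemma sum_moebius_conv {Y : ℕ → ℂ} (hY1 : Y 1 = 1) (hY : ∀ a b, Y (a * b) = Y a * Y b)
    {n : ℕ} (hn : 0 < n) (f : ℕ → ℕ → ℂ) :
    ∑ p ∈ n.divisorsAntidiagonal, ∑ r ∈ p.2.divisorsAntidiagonal,
      ((ArithmeticFunction.moebius p.1 : ℂ) * Y p.1) * (Y r.1 * f (p.1 * r.1) r.2) = f 1 n := by
  rw [sum_divisorsAntidiagonal_assoc n fun a b c =>
    ((ArithmeticFunction.moebius a : ℂ) * Y a) * (Y b * f (a * b) c)]
  have h : ∀ p ∈ n.divisorsAntidiagonal, ∑ r ∈ p.1.divisorsAntidiagonal,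
      ((ArithmeticFunction.moebius r.1 : ℂ) * Y r.1) * (Y r.2 * f (r.1 * r.2) p.2) =
      if p = (1, n) then f 1 n else 0 := by
    intro p hp
    obtain ⟨rfl, -⟩ := Nat.mem_divisorsAntidiagonal.1 hp
    have h1 : ∀ r ∈ p.1.divisorsAntidiagonal,
        ((ArithmeticFunction.moebius r.1 : ℂ) * Y r.1) * (Y r.2 * f (r.1 * r.2) p.2) =
        (ArithmeticFunction.moebius r.1 : ℂ) * (Y p.1 * f p.1 p.2) := by
      intro r hr
      rw [← (Nat.mem_divisorsAntidiagonal.1 hr).1, hY]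
      ring
    rw [sum_congr rfl h1, ← sum_mul,
      Nat.sum_divisorsAntidiagonal (f := fun a _ => (ArithmeticFunction.moebius a : ℂ))]
    have := congrArg (fun f => f p.1) (ArithmeticFunction.coe_zeta_mul_coe_moebius (R := ℂ))
    simp only [ArithmeticFunction.coe_zeta_mul_apply, ArithmeticFunction.one_apply,
      ArithmeticFunction.intCoe_apply] at this
    rw [this]
    by_cases h2 : p.1 = 1
    · obtain ⟨a, b⟩ := p
      simp only at h2
      subst h2
      simp [hY1]
    · have : p ≠ (1, p.1 * p.2) := fun h => h2 (congrArg Prod.fst h)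
      simp [h2, this]
  rw [sum_congr rfl h]
  simp [hn.ne']

/-- `chainSum` inverts `heckeSum`. -/
lemma chainSum_heckeSum {Y : ℕ → ℂ} (hY1 : Y 1 = 1) (hY : ∀ a b, Y (a * b) = Y a * Y b)
    (n : ℕ) (D : (Fin n → ℕ) → ℂ) {t : ℕ} (t' : ℕ) (m : Fin n → ℕ) (ht : 0 < t)
    (hm : ∀ i, 0 < m i) :
    chainSum (fun a => (ArithmeticFunction.moebius a : ℂ) * Y a) n
      (fun m' => heckeSum Y n D t' m') t m = D (mulHead (t' * t) m) := by
  induction n generalizing t t' with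
  | zero =>
    simp only [chainSum, heckeSum]
    congr 1
    exact Subsingleton.elim _ _
  | succ n ih =>
    simp only [chainSum, heckeSum, Fin.cons_zero, Fin.tail_cons, chainSum_sum]
    have h : ∀ p ∈ (t * m 0).divisorsAntidiagonal, ∀ r ∈ p.2.divisorsAntidiagonal,
        Y r.1 * chainSum (fun a => (ArithmeticFunction.moebius a : ℂ) * Y a) n
          (fun m' => heckeSum Y n (fun m' => D (Fin.cons (t' * r.2) m')) r.1 m') p.1 (Fin.tail m) =
        Y r.1 * D (Fin.cons (t' * r.2) (mulHead (p.1 * r.1) (Fin.tail m))) := by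
      intro p hp r hr
      rw [ih (ht := Nat.pos_of_ne_zero (Nat.ne_zero_of_mem_divisorsAntidiagonal hp).1) (m := Fin.tail m)
        (hm := fun i => hm i.succ), mul_comm p.1]
    rw [sum_congr rfl fun p hp => by rw [sum_congr rfl (h p hp)]]
    simp_rw [mul_sum]
    rw [sum_moebius_conv hY1 hY (Nat.mul_pos ht (hm 0))
      (fun a b => D (Fin.cons (t' * b) (mulHead a (Fin.tail m)))), mulHead_one, mulHead_succ,
      mul_assoc]

/-- `splitSum` as a chain sum in the `eᵢ`, with the sum over the `hᵢ` taken inside. -/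
lemma splitSum_eq (w Y : ℕ → ℂ) (n : ℕ) (D : (Fin (n + 1) → ℕ) → ℂ) (l : ℕ) (q : Fin n → ℕ) :
    splitSum w Y n D l q = ∑ p ∈ l.divisorsAntidiagonal, w p.1 *
      chainSum w n (fun m => dualHeckeSum Y n D p.2 m) p.1 q := by
  induction n generalizing l with
  | zero => simp only [splitSum, chainSum, dualHeckeSum]
  | succ n ih =>
    simp only [splitSum, chainSum, dualHeckeSum, ih, Fin.cons_zero, Fin.tail_cons, chainSum_sum,
      mul_sum]
    refine sum_congr rfl fun p _ => ?_
    rw [mul_comm (q 0)]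
    rw [sum_divisorsAntidiagonal_left_comm (p.1 * q 0) fun a b c => w p.1 * (Y a * (w b *
      chainSum w n (fun m => dualHeckeSum Y n (fun m' => D (Fin.cons (p.2 * a) m')) c m)
        b (Fin.tail q)))]
    refine sum_congr rfl fun r _ => sum_congr rfl fun x _ => ?_
    ring

/-- The identity that matches the two sides of the Voronoi formula: the chain sum of a dual Hecke
sum is, up to a convolution in the first variable, the sum `splitSum`. The conditions
`e_{i+1} hᵢ ∣ qᵢ eᵢ` on the divisors are the same in both. -/
lemma sum_splitSum (w Y : ℕ → ℂ) (n : ℕ) (D : (Fin (n + 1) → ℕ) → ℂ) (l : ℕ) (q : Fin n → ℕ) :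
    ∑ p ∈ l.divisorsAntidiagonal, Y p.1 * splitSum w Y n D p.2 q =
      chainSum w (n + 1) (fun m => ∑ p ∈ (m 0).divisorsAntidiagonal,
        Y p.1 * dualHeckeSum Y n D p.2 (Fin.tail m)) 1 (Fin.cons l q) := by
  simp only [splitSum_eq, chainSum, Fin.cons_zero, Fin.tail_cons, chainSum_sum, one_mul, mul_sum]
  rw [sum_divisorsAntidiagonal_left_comm l fun a b c => Y a * (w b *
      chainSum w n (fun m => dualHeckeSum Y n D c m) b q)]
  refine sum_congr rfl fun r _ => sum_congr rfl fun x _ => ?_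
  ring

lemma differentiable_chainSum (w : ℂ → ℕ → ℂ) (hw : ∀ a, Differentiable ℂ fun s => w s a)
    (n : ℕ) (B : (Fin n → ℕ) → ℂ) (t : ℕ) (m : Fin n → ℕ) :
    Differentiable ℂ fun s => chainSum (w s) n B t m := by
  induction n generalizing t with
  | zero => exact differentiable_const _
  | succ n ih =>
    simp only [chainSum]
    exact Differentiable.fun_sum fun p _ => (hw _).mul (ih _ _ _)

/-! ### Hecke relations summed to Dirichlet series -/

lemma sum_piFinset_succ {M : Type*} [AddCommMonoid M] {n : ℕ} (S : Fin (n + 1) → Finset ℕ)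
    (F : (Fin (n + 1) → ℕ) → M) :
    ∑ d ∈ Fintype.piFinset S, F d =
      ∑ x ∈ S 0, ∑ y ∈ Fintype.piFinset fun i => S i.succ, F (Fin.cons x y) := by
  rw [← sum_product']
  refine sum_nbij' (fun d => (d 0, Fin.tail d)) (fun p => Fin.cons p.1 p.2) ?_ ?_ ?_ ?_ ?_
  · intro d hd
    rw [Fin.mem_piFinset_iff_zero_tail] at hd
    exact mem_product.2 hd
  · intro p hp
    rw [Fin.mem_piFinset_iff_zero_tail]
    exact mem_product.1 hp
  all_goals simp

lemma heckeSum_eq (Y : ℕ → ℂ) (n : ℕ) (D : (Fin n → ℕ) → ℂ) (t : ℕ) (m : Fin n → ℕ) :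
    heckeSum Y n D t m = ∑ d ∈ Fintype.piFinset fun i => (m i).divisors, (∏ i, Y (d i)) *
      D fun i => (Fin.cons t d : Fin (n + 1) → ℕ) i.castSucc * (m i / d i) := by
  induction n generalizing t with
  | zero =>
    simp only [heckeSum, Fintype.piFinset_of_isEmpty, univ_unique, sum_singleton, univ_eq_empty,
      prod_empty, one_mul]
    congr 1
    exact Subsingleton.elim _ _
  | succ n ih =>
    simp only [heckeSum, ih]
    rw [sum_piFinset_succ, Nat.sum_divisorsAntidiagonal (f := fun a b => Y a * ∑ d ∈
      Fintype.piFinset fun i => (Fin.tail m i).divisors, (∏ i, Y (d i)) * D (Fin.cons (t * b)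
        fun i => (Fin.cons a d : Fin (n + 1) → ℕ) i.castSucc * (Fin.tail m i / d i)))]
    refine sum_congr rfl fun x _ => ?_
    rw [mul_sum]
    refine sum_congr rfl fun y _ => ?_
    rw [Fin.prod_univ_succ, ← mul_assoc]
    simp only [Fin.cons_zero, Fin.cons_succ]
    congr 2
    funext i
    cases i using Fin.cases <;> simp [Fin.tail]

lemma dualHeckeSum_eq (Y : ℕ → ℂ) (n : ℕ) (D : (Fin (n + 1) → ℕ) → ℂ) (u : ℕ) (m : Fin n → ℕ) :
    dualHeckeSum Y n D u m = ∑ d ∈ Fintype.piFinset fun i => (m i).divisors, (∏ i, Y (d i)) *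
      D fun i => (Fin.cons u (fun j => m j / d j) : Fin (n + 1) → ℕ) i *
        (Fin.snoc d 1 : Fin (n + 1) → ℕ) i := by
  induction n generalizing u with
  | zero =>
    simp only [dualHeckeSum, Fintype.piFinset_of_isEmpty, univ_unique, sum_singleton,
      univ_eq_empty, prod_empty, one_mul]
    congr 1
    funext i
    rw [Fin.fin_one_eq_zero i]
    simp [Fin.snoc]
  | succ n ih =>
    simp only [dualHeckeSum, ih]
    rw [sum_piFinset_succ, Nat.sum_divisorsAntidiagonal (f := fun a b => Y a * ∑ d ∈
      Fintype.piFinset fun i => (Fin.tail m i).divisors, (∏ i, Y (d i)) * D (Fin.cons (u * a)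
        fun i => (Fin.cons b (fun j => Fin.tail m j / d j) : Fin (n + 1) → ℕ) i *
          (Fin.snoc d 1 : Fin (n + 1) → ℕ) i))]
    refine sum_congr rfl fun x _ => ?_
    rw [mul_sum]
    refine sum_congr rfl fun y _ => ?_
    rw [Fin.prod_univ_succ, ← mul_assoc]
    simp only [Fin.cons_zero, Fin.cons_succ]
    congr 2
    rw [← Fin.cons_snoc_eq_snoc_cons]
    funext i
    cases i using Fin.cases with
    | zero => simp
    | succ i =>
      simp only [Fin.cons_succ]
      congr 1
      cases i using Fin.cases <;> simp [Fin.tail]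

lemma LSeries_term_dilate {P : ℕ} (hP : 0 < P) (g : ℕ → ℂ) (s : ℂ) :
    (LSeries.term (fun n => if P ∣ n then g (n / P) else 0) s) ∘ (fun n => P * n) =
      fun n => (P : ℂ) ^ (-s) * LSeries.term g s n := by
  funext n
  rcases eq_or_ne n 0 with rfl | hn
  · simp
  · rw [Function.comp_apply, LSeries.term_of_ne_zero (mul_ne_zero hP.ne' hn),
      LSeries.term_of_ne_zero hn, if_pos (dvd_mul_right _ _), Nat.mul_div_cancel_left _ hP,
      Nat.cast_mul, Complex.natCast_mul_natCast_cpow, Complex.cpow_neg]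
    field_simp

lemma support_term_dilate {P : ℕ} (g : ℕ → ℂ) (s : ℂ) :
    Function.support (LSeries.term (fun n => if P ∣ n then g (n / P) else 0) s) ⊆
      Set.range fun n => P * n := by
  intro n hn
  by_contra h
  refine hn ?_
  rcases eq_or_ne n 0 with rfl | hn0
  · simp
  · rw [LSeries.term_of_ne_zero hn0, if_neg, zero_div]
    rintro ⟨x, rfl⟩
    exact h ⟨x, rfl⟩

lemma LSeries_dilate {P : ℕ} (hP : 0 < P) (g : ℕ → ℂ) (s : ℂ) :
    LSeries (fun n => if P ∣ n then g (n / P) else 0) s = (P : ℂ) ^ (-s) * LSeries g s := by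
  have hinj : Function.Injective fun n : ℕ => P * n := fun a b h => Nat.eq_of_mul_eq_mul_left hP h
  rw [LSeries, ← hinj.tsum_eq (support_term_dilate g s)]
  have := LSeries_term_dilate hP g s
  simp only [funext_iff, Function.comp_apply] at this
  simp_rw [this]
  rw [tsum_mul_left, LSeries]

lemma LSeriesSummable_dilate {P : ℕ} (hP : 0 < P) {g : ℕ → ℂ} {s : ℂ} (h : LSeriesSummable g s) :
    LSeriesSummable (fun n => if P ∣ n then g (n / P) else 0) s := by
  have hinj : Function.Injective fun n : ℕ => P * n := fun a b h => Nat.eq_of_mul_eq_mul_left hP h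
  rw [LSeriesSummable, ← hinj.summable_iff, LSeries_term_dilate hP]
  · exact h.mul_left _
  · intro n hn
    by_contra h
    exact hn (support_term_dilate g s h)

/-- A sum over `heckeTuples n m` is a sum over independent divisors `d₁ ∣ m₁, …`, the remaining
entry `d₀` being determined by `n`. -/
lemma sum_heckeTuples {k n : ℕ} (hn : n ≠ 0) (m : Fin (k + 1) → ℕ) (hm : ∀ i, 0 < m i)
    (Φ : (Fin (k + 2) → ℕ) → ℂ) :
    ∑ d ∈ heckeTuples n m, Φ d = ∑ d ∈ Fintype.piFinset fun i => (m i).divisors,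
      if ∏ i, d i ∣ n then Φ (Fin.cons (n / ∏ i, d i) d) else 0 := by
  have hprod : ∀ d ∈ heckeTuples n m, d 0 * ∏ i, Fin.tail d i = n := by
    intro d hd
    rw [heckeTuples, mem_filter, Nat.mem_finMulAntidiag] at hd
    rw [← hd.1.1, Fin.prod_univ_succ d]
    rfl
  have hhead : ∀ d ∈ heckeTuples n m,
      (Fin.cons (n / ∏ i, Fin.tail d i) (Fin.tail d) : Fin (k + 2) → ℕ) = d := by
    intro d hd
    have h := hprod d hd
    have hpos : 0 < ∏ i, Fin.tail d i :=
      Nat.pos_of_ne_zero fun h0 => hn (by rw [← h, h0, mul_zero])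
    have h0 : n / ∏ i, Fin.tail d i = d 0 := by
      rw [← h]
      exact Nat.mul_div_cancel _ hpos
    rw [h0, Fin.cons_self_tail]
  rw [← sum_filter]
  refine sum_nbij' (fun d => Fin.tail d) (fun d => Fin.cons (n / ∏ i, d i) d) ?_ ?_ hhead ?_ ?_
  · intro d hd
    rw [mem_filter, Fintype.mem_piFinset]
    refine ⟨fun i => Nat.mem_divisors.2 ⟨(mem_filter.1 hd).2 i, (hm i).ne'⟩, ⟨d 0, ?_⟩⟩
    rw [mul_comm, hprod d hd]
  · intro d hd
    rw [mem_filter, Fintype.mem_piFinset] at hd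
    rw [heckeTuples, mem_filter, Nat.mem_finMulAntidiag, Fin.prod_univ_succ]
    simp only [Fin.cons_zero, Fin.cons_succ]
    exact ⟨⟨Nat.div_mul_cancel hd.2, hn⟩, fun i => (Nat.mem_divisors.1 (hd.1 i)).1⟩
  · simp
  · intro d hd
    rw [hhead d hd]

/-- The summand `χ(n) n^{-s}` of a Dirichlet `L`-series, as a completely multiplicative weight. -/
noncomputable def charWeight {c : ℕ} (χ : DirichletCharacter ℂ c) (s : ℂ) (n : ℕ) : ℂ :=
  χ (n : ZMod c) * (n : ℂ) ^ (-s)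

lemma charWeight_one {c : ℕ} (χ : DirichletCharacter ℂ c) (s : ℂ) : charWeight χ s 1 = 1 := by
  simp [charWeight]

lemma charWeight_mul {c : ℕ} (χ : DirichletCharacter ℂ c) (s : ℂ) (a b : ℕ) :
    charWeight χ s (a * b) = charWeight χ s a * charWeight χ s b := by
  simp only [charWeight, Nat.cast_mul, map_mul, Complex.natCast_mul_natCast_cpow]
  ring

lemma charWeight_prod {c n : ℕ} (χ : DirichletCharacter ℂ c) (s : ℂ) (d : Fin n → ℕ) :
    charWeight χ s (∏ i, d i) = ∏ i, charWeight χ s (d i) := by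
  induction n with
  | zero => simp [charWeight_one]
  | succ n ih => rw [Fin.prod_univ_succ, Fin.prod_univ_succ, charWeight_mul, ih]

/-- Summing a Hecke relation against `χ(n) n^{-s}`. -/
lemma LSeries_heckeTuples {k c : ℕ} (χ : DirichletCharacter ℂ c) (m : Fin (k + 1) → ℕ)
    (hm : ∀ i, 0 < m i) (Φ : (Fin (k + 2) → ℕ) → ℂ) (s : ℂ)
    (hs : ∀ d ∈ Fintype.piFinset fun i => (m i).divisors,
      LSeriesSummable (fun n => Φ (Fin.cons n d) * χ (n : ZMod c)) s) :
    LSeries (fun n => (∑ d ∈ heckeTuples n m, Φ d) * χ (n : ZMod c)) s =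
      ∑ d ∈ Fintype.piFinset fun i => (m i).divisors, (∏ i, charWeight χ s (d i)) *
        LSeries (fun n => Φ (Fin.cons n d) * χ (n : ZMod c)) s := by
  have hpos : ∀ d ∈ Fintype.piFinset fun i => (m i).divisors, 0 < ∏ i, d i := by
    intro d hd
    rw [Fintype.mem_piFinset] at hd
    exact prod_pos fun i _ => Nat.pos_of_mem_divisors (hd i)
  have h1 : LSeries (fun n => (∑ d ∈ heckeTuples n m, Φ d) * χ (n : ZMod c)) s =
      LSeries (∑ d ∈ Fintype.piFinset fun i => (m i).divisors,
        χ ((∏ i, d i : ℕ) : ZMod c) • fun n => if ∏ i, d i ∣ n then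
          (fun n => Φ (Fin.cons n d) * χ (n : ZMod c)) (n / ∏ i, d i) else 0) s := by
    refine LSeries_congr (fun {n} hn => ?_) s
    rw [sum_heckeTuples hn m hm, Finset.sum_apply, sum_mul]
    refine sum_congr rfl fun d hd => ?_
    simp only [Pi.smul_apply, smul_eq_mul]
    split_ifs with h
    · obtain ⟨x, rfl⟩ := h
      rw [Nat.mul_div_cancel_left _ (hpos d hd), Nat.cast_mul, map_mul]
      ring
    · simp
  rw [h1, LSeries_sum fun d hd => (LSeriesSummable_dilate (hpos d hd) (hs d hd)).smul _]
  refine sum_congr rfl fun d hd => ?_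
  rw [LSeries_smul, LSeries_dilate (hpos d hd)
    (fun n => Φ (Fin.cons n d) * χ (n : ZMod c)), ← charWeight_prod, charWeight]
  ring

lemma ModerateGrowth.dual {k : ℕ} {A : (Fin (k + 1) → ℕ) → ℂ} {σ : ℝ}
    (h : ModerateGrowth A σ) : ModerateGrowth (dual A) σ := by
  obtain ⟨C, hC⟩ := h
  refine ⟨C, fun m hm => ?_⟩
  have := hC (fun i => m i.rev) fun i => hm _
  rwa [show ∏ i : Fin (k + 1), m i.rev = ∏ i, m i from Equiv.prod_comp Fin.revPerm m] at this

lemma ModerateGrowth.summable {k : ℕ} {A : (Fin (k + 1) → ℕ) → ℂ} {σ : ℝ}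
    (h : ModerateGrowth A σ) {g : ℕ → Fin (k + 1) → ℕ} {P : ℕ}
    (hg : ∀ n, n ≠ 0 → (∀ i, 0 < g n i) ∧ ∏ i, g n i = n * P) {b : ℕ → ℂ} {K : ℝ}
    (hb : ∀ n, ‖b n‖ ≤ K) {s : ℂ} (hs : 1 + σ < s.re) :
    LSeriesSummable (fun n => A (g n) * b n) s := by
  obtain ⟨C, hC⟩ := h
  refine LSeriesSummable_of_le_const_mul_rpow hs ⟨C * (P : ℝ) ^ σ * K, fun n hn => ?_⟩
  obtain ⟨h1, h2⟩ := hg n hn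
  have h3 := hC (g n) h1
  rw [h2, Nat.cast_mul, Real.mul_rpow (by positivity) (by positivity)] at h3
  rw [norm_mul, add_sub_cancel_left]
  calc ‖A (g n)‖ * ‖b n‖ ≤ (C * ((n : ℝ) ^ σ * (P : ℝ) ^ σ)) * K :=
        mul_le_mul h3 (hb n) (norm_nonneg _) ((norm_nonneg _).trans h3)
    _ = C * (P : ℝ) ^ σ * K * (n : ℝ) ^ σ := by ring

/-- Multiply the last entry of a tuple by `t`. -/
def mulLast {n : ℕ} (t : ℕ) (m : Fin (n + 1) → ℕ) : Fin (n + 1) → ℕ :=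
  fun i => if i = Fin.last n then t * m i else m i

lemma mulHead_pos {k n : ℕ} (hn : n ≠ 0) {m : Fin (k + 1) → ℕ} (hm : ∀ i, 0 < m i) :
    (∀ i, 0 < mulHead n m i) ∧ ∏ i, mulHead n m i = n * ∏ i, m i := by
  constructor
  · intro i
    have := hm i
    unfold mulHead
    split_ifs <;> positivity
  · rw [mulHead_succ, Fin.prod_univ_succ, Fin.prod_univ_succ]
    simp [Fin.tail, mul_assoc]

lemma mulLast_pos {k n : ℕ} (hn : n ≠ 0) {m : Fin (k + 1) → ℕ} (hm : ∀ i, 0 < m i) :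
    (∀ i, 0 < mulLast n m i) ∧ ∏ i, mulLast n m i = n * ∏ i, m i := by
  constructor
  · intro i
    have := hm i
    unfold mulLast
    split_ifs <;> positivity
  · rw [Fin.prod_univ_castSucc, Fin.prod_univ_castSucc]
    simp only [mulLast, Fin.castSucc_ne_last, if_false, if_true]
    ring

lemma dirichletChar_norm_le {c : ℕ} (χ : DirichletCharacter ℂ c) (n : ℕ) :
    ‖χ (n : ZMod c)‖ ≤ 1 := χ.norm_le_one _

/-- The Dirichlet series of `n ↦ B(n m₁, m₂, …) χ(n)`. -/
noncomputable def headSeries {k c : ℕ} (B : (Fin (k + 1) → ℕ) → ℂ) (χ : DirichletCharacter ℂ c)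
    (s : ℂ) (m : Fin (k + 1) → ℕ) : ℂ :=
  LSeries (fun n => B (mulHead n m) * χ (n : ZMod c)) s

/-- The Dirichlet series of `n ↦ B(m₁, …, m_{N-2}, n m_{N-1}) χ(n)`. -/
noncomputable def lastSeries {k c : ℕ} (B : (Fin (k + 1) → ℕ) → ℂ) (χ : DirichletCharacter ℂ c)
    (s : ℂ) (m : Fin (k + 1) → ℕ) : ℂ :=
  LSeries (fun n => B (mulLast n m) * χ (n : ZMod c)) s

/-- The relation `mul_end`, summed over `n`. -/
lemma LSeries_mul_dual {k c : ℕ} {A : (Fin (k + 1) → ℕ) → ℂ} (hecke : HeckeRelations A) {σ : ℝ}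
    (growth : ModerateGrowth A σ) (χ : DirichletCharacter ℂ c) {s : ℂ} (hs : 1 + σ < s.re)
    (m : Fin (k + 1) → ℕ) (hm : ∀ i, 0 < m i) :
    LSeries (twistedCoeff A χ) s * dual A m =
      heckeSum (charWeight χ s) (k + 1) (headSeries (dual A) χ s) 1 m := by
  have hshift : ∀ d ∈ Fintype.piFinset fun i => (m i).divisors, ∀ n,
      heckeShift m (Fin.cons n d) =
        mulHead n fun i => (Fin.cons 1 d : Fin (k + 2) → ℕ) i.castSucc * (m i / d i) := by
    intro d hd n
    simp only [Fintype.mem_piFinset, Nat.mem_divisors] at hd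
    funext i
    rw [heckeShift, Fin.cons_succ, mul_comm, Nat.mul_div_assoc _ (hd i).1]
    cases i using Fin.cases <;> simp [mulHead]
  have hpos : ∀ d ∈ Fintype.piFinset fun i => (m i).divisors, ∀ i,
      0 < (Fin.cons 1 d : Fin (k + 2) → ℕ) i.castSucc * (m i / d i) := by
    intro d hd i
    simp only [Fintype.mem_piFinset, Nat.mem_divisors] at hd
    have hdp : ∀ j, 0 < d j := fun j => Nat.pos_of_dvd_of_pos (hd j).1 (hm j)
    refine Nat.mul_pos ?_ (Nat.div_pos (Nat.le_of_dvd (hm i) (hd i).1) (hdp i))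
    cases i using Fin.cases with
    | zero => simp
    | succ i => rw [← Fin.succ_castSucc, Fin.cons_succ]; exact hdp _
  rw [heckeSum_eq, mul_comm, ← LSeries_smul]
  rw [LSeries_congr (g := fun n => (∑ d ∈ heckeTuples n m, dual A (heckeShift m d)) *
      χ (n : ZMod c)) (fun {n} hn => ?_) s, LSeries_heckeTuples χ m hm (fun d => dual A (heckeShift m d))]
  · refine sum_congr rfl fun d hd => ?_
    rw [headSeries]
    simp only [hshift d hd]
  · intro d hd
    simp only [hshift d hd]
    exact growth.dual.summable (fun n hn => mulHead_pos hn (hpos d hd))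
      (dirichletChar_norm_le χ) hs
  · have := hecke.mul_end n m (Nat.pos_of_ne_zero hn) hm
    simp only [Pi.smul_apply, smul_eq_mul, twistedCoeff]
    simp only [dual]
    rw [← this]
    ring

/-- The relation `mul_start`, summed over `n`. -/
lemma LSeries_dual_mul_dual {k c : ℕ} {A : (Fin (k + 1) → ℕ) → ℂ} (hecke : HeckeRelations A)
    {σ : ℝ} (growth : ModerateGrowth A σ) (χ : DirichletCharacter ℂ c) {s : ℂ}
    (hs : 1 + σ < s.re) (m : Fin (k + 1) → ℕ) (hm : ∀ i, 0 < m i) :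
    LSeries (twistedCoeff (dual A) χ) s * dual A m =
      ∑ p ∈ (m 0).divisorsAntidiagonal, charWeight χ s p.1 *
        dualHeckeSum (charWeight χ s) k (lastSeries (dual A) χ s) p.2 (Fin.tail m) := by
  have hrhs : ∑ p ∈ (m 0).divisorsAntidiagonal, charWeight χ s p.1 *
        dualHeckeSum (charWeight χ s) k (lastSeries (dual A) χ s) p.2 (Fin.tail m) =
      ∑ d ∈ Fintype.piFinset fun i => (m i).divisors, (∏ i, charWeight χ s (d i)) *
        lastSeries (dual A) χ s fun i => m i / d i *
          (Fin.snoc (Fin.tail d) 1 : Fin (k + 1) → ℕ) i := by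
    simp only [dualHeckeSum_eq]
    rw [sum_piFinset_succ, Nat.sum_divisorsAntidiagonal (f := fun a b => charWeight χ s a * ∑ d ∈
      Fintype.piFinset fun i => (Fin.tail m i).divisors, (∏ i, charWeight χ s (d i)) *
        lastSeries (dual A) χ s fun i => (Fin.cons b (fun j => Fin.tail m j / d j) :
          Fin (k + 1) → ℕ) i * (Fin.snoc d 1 : Fin (k + 1) → ℕ) i)]
    refine sum_congr rfl fun x _ => ?_
    rw [mul_sum]
    refine sum_congr rfl fun y _ => ?_
    rw [Fin.prod_univ_succ, ← mul_assoc]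
    simp only [Fin.cons_zero, Fin.cons_succ, Fin.tail_cons]
    congr 2
    funext i
    congr 1
    cases i using Fin.cases <;> simp [Fin.tail]
  have hshift : ∀ d ∈ Fintype.piFinset fun i => (m i).divisors, ∀ n,
      A (heckeShift (fun i => m i.rev) (Fin.cons n fun i => d i.rev)) = dual A
        (mulLast n fun i => m i / d i * (Fin.snoc (Fin.tail d) 1 : Fin (k + 1) → ℕ) i) := by
    intro d hd n
    simp only [Fintype.mem_piFinset, Nat.mem_divisors] at hd
    rw [dual]
    congr 1
    funext i
    rw [heckeShift, Fin.cons_succ, mul_comm, Nat.mul_div_assoc _ (hd i.rev).1, mulLast]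
    cases i using Fin.cases with
    | zero => simp
    | succ i =>
      rw [← Fin.succ_castSucc, Fin.cons_succ, Fin.rev_succ, if_neg (Fin.castSucc_ne_last _),
        Fin.snoc_castSucc, mul_comm, Fin.rev_castSucc]
      rfl
  have hpos : ∀ d ∈ Fintype.piFinset fun i => (m i).divisors, ∀ i,
      0 < m i / d i * (Fin.snoc (Fin.tail d) 1 : Fin (k + 1) → ℕ) i := by
    intro d hd i
    simp only [Fintype.mem_piFinset, Nat.mem_divisors] at hd
    have hdp : ∀ j, 0 < d j := fun j => Nat.pos_of_dvd_of_pos (hd j).1 (hm j)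
    refine Nat.mul_pos (Nat.div_pos (Nat.le_of_dvd (hm i) (hd i).1) (hdp i)) ?_
    cases i using Fin.lastCases with
    | last => simp
    | cast i => rw [Fin.snoc_castSucc]; exact hdp _
  have hrev : ∀ d : Fin (k + 1) → ℕ, (d ∈ Fintype.piFinset fun i => (m i).divisors) ↔
      (fun i : Fin (k + 1) => d i.rev) ∈
        Fintype.piFinset fun i : Fin (k + 1) => (m i.rev).divisors := by
    intro d
    simp only [Fintype.mem_piFinset]
    exact ⟨fun h i => h _, fun h i => by simpa using h i.rev⟩
  rw [hrhs, mul_comm, ← LSeries_smul]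
  rw [LSeries_congr (g := fun n => (∑ d ∈ heckeTuples n (fun i => m i.rev),
      A (heckeShift (fun i => m i.rev) d)) * χ (n : ZMod c)) (fun {n} hn => ?_) s,
      LSeries_heckeTuples χ (fun i => m i.rev) (fun i => hm _)
        (fun d => A (heckeShift (fun i => m i.rev) d))]
  · symm
    refine sum_nbij' (fun d (i : Fin (k + 1)) => d i.rev)
      (fun d (i : Fin (k + 1)) => d i.rev) (fun d hd => (hrev d).1 hd)
      (fun d hd => (hrev _).2 (by simpa using hd)) (fun d _ => by simp) (fun d _ => by simp) ?_
    intro d hd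
    rw [lastSeries, show ∏ i : Fin (k + 1), charWeight χ s (d i.rev) =
      ∏ i, charWeight χ s (d i) from Equiv.prod_comp Fin.revPerm fun i => charWeight χ s (d i)]
    simp only [hshift d hd]
  · intro d hd
    obtain ⟨d, rfl⟩ : ∃ d' : Fin (k + 1) → ℕ, d = fun i => d' i.rev :=
      ⟨fun i => d i.rev, by simp⟩
    have hd := (hrev d).2 hd
    simp only [hshift d hd]
    exact growth.dual.summable (fun n hn => mulLast_pos hn (hpos d hd))
      (dirichletChar_norm_le χ) hs
  · have := hecke.mul_start n (fun i => m i.rev) (Nat.pos_of_ne_zero hn) fun i => hm _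
    have h1 : dual A (endTuple (fun _ => 1) n) = A (startTuple n fun _ => 1) := by
      rw [dual]
      congr 1
      funext i
      simp [endTuple, startTuple]
    simp only [Pi.smul_apply, smul_eq_mul, twistedCoeff, h1]
    rw [← this, dual]
    ring

/-! ### Levels, weights and Gauss sums on the dual side -/

@[simp] lemma level_zero {k : ℕ} (c : ℕ) (q d : Fin k → ℕ) : level c q d 0 = c := by
  simp [level]

lemma level_succ {k c r : ℕ} {q d : Fin (k + 1) → ℕ} (h : d 0 * r = q 0 * c) (hd : 0 < d 0)
    (i : Fin (k + 1)) : level c q d i.succ = level r (Fin.tail q) (Fin.tail d) i := by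
  have key : ∀ f : Fin (k + 1) → ℕ, ∏ j with j.castSucc < i.succ, f j =
      f 0 * ∏ j with j.castSucc < i, Fin.tail f j := by
    intro f
    rw [prod_filter, prod_filter, Fin.prod_univ_succ, Fin.castSucc_zero, if_pos (Fin.succ_pos i)]
    simp only [← Fin.succ_castSucc, Fin.succ_lt_succ_iff, Fin.tail]
  rw [level, level, key, key, mul_right_comm, ← h, mul_assoc, Nat.mul_div_mul_left _ _ hd,
    mul_comm r]

/-- The divisibility chain that defines `divTuples` bounds all its entries. -/
lemma dvd_prod_mul_of_chain {k b c : ℕ} (hc : 0 < c) {q d : Fin k → ℕ} (hq : ∀ i, 0 < q i)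
    (h : ∀ i : Fin k, d i * b ∣ q i * level c q d i.castSucc) (i : Fin k) :
    d i ∣ (∏ j, q j) * c := by
  induction k generalizing c with
  | zero => exact i.elim0
  | succ k ih =>
    have h0 : d 0 ∣ q 0 * c := by
      have := h 0
      rw [Fin.castSucc_zero, level_zero] at this
      exact dvd_of_mul_right_dvd this
    obtain ⟨r, hr⟩ := h0
    have hpos : 0 < d 0 * r := hr ▸ Nat.mul_pos (hq 0) hc
    have hd : 0 < d 0 := Nat.pos_of_mul_pos_right hpos
    have heq : (∏ j, q j) * c = d 0 * ((∏ j, Fin.tail q j) * r) := by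
      rw [Fin.prod_univ_succ, mul_right_comm, hr]
      simp only [Fin.tail]
      ring
    rw [heq]
    cases i using Fin.cases with
    | zero => exact dvd_mul_right _ _
    | succ i =>
      refine Dvd.dvd.mul_left (ih (d := Fin.tail d) (Nat.pos_of_mul_pos_left hpos)
        (fun j => hq j.succ) (fun j => ?_) i) _
      have := h j.succ
      rwa [← Fin.succ_castSucc, level_succ hr.symm hd] at this

lemma mem_divTuples {k b c : ℕ} (hc : 0 < c) {q : Fin k → ℕ} (hq : ∀ i, 0 < q i)
    {d : Fin k → ℕ} :
    d ∈ divTuples b c q ↔ ∀ i : Fin k, d i * b ∣ q i * level c q d i.castSucc := by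
  rw [divTuples, mem_filter, Fintype.mem_piFinset, and_iff_right_iff_imp]
  intro h i
  exact Nat.mem_divisors.2 ⟨dvd_prod_mul_of_chain hc hq h i,
    (Nat.mul_pos (prod_pos fun j _ => hq j) hc).ne'⟩

lemma pos_of_mem_divTuples {k b c : ℕ} {q d : Fin k → ℕ} (h : d ∈ divTuples b c q) (i : Fin k) :
    0 < d i :=
  Nat.pos_of_mem_divisors (Fintype.mem_piFinset.1 (mem_filter.1 h).1 i)

lemma mem_divTuples_succ {k b l : ℕ} (hb : 0 < b) (hl : 0 < l) {q : Fin (k + 1) → ℕ}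
    (hq : ∀ i, 0 < q i) {d : Fin (k + 1) → ℕ} :
    d ∈ divTuples b (b * l) q ↔ d 0 ∣ q 0 * l ∧
      Fin.tail d ∈ divTuples b (b * (q 0 * l / d 0)) (Fin.tail q) := by
  rw [mem_divTuples (Nat.mul_pos hb hl) hq, Fin.forall_fin_succ, Fin.castSucc_zero, level_zero,
    mul_left_comm, mul_comm (d 0), Nat.mul_dvd_mul_iff_left hb]
  refine and_congr_right fun h => ?_
  obtain ⟨r, hr⟩ := h
  have hpos : 0 < d 0 * r := hr ▸ Nat.mul_pos (hq 0) hl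
  have hd : 0 < d 0 := Nat.pos_of_mul_pos_right hpos
  rw [hr, Nat.mul_div_cancel_left _ hd, mem_divTuples (q := Fin.tail q)
    (Nat.mul_pos hb (Nat.pos_of_mul_pos_left hpos)) (fun i => hq i.succ)]
  have hr' : d 0 * (b * r) = q 0 * (b * l) := by
    rw [mul_left_comm, ← hr, mul_left_comm]
  simp only [← Fin.succ_castSucc, level_succ hr' hd, Fin.tail]

lemma sum_divTuples_succ {k b l : ℕ} (hb : 0 < b) (hl : 0 < l) {q : Fin (k + 1) → ℕ}
    (hq : ∀ i, 0 < q i) (F : (Fin (k + 1) → ℕ) → ℂ) :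
    ∑ d ∈ divTuples b (b * l) q, F d = ∑ r ∈ (q 0 * l).divisorsAntidiagonal,
      ∑ d ∈ divTuples b (b * r.2) (Fin.tail q), F (Fin.cons r.1 d) := by
  rw [sum_sigma']
  refine sum_nbij' (fun d => ⟨(d 0, q 0 * l / d 0), Fin.tail d⟩) (fun x => Fin.cons x.1.1 x.2)
    ?_ ?_ ?_ ?_ ?_
  · intro d hd
    rw [mem_divTuples_succ hb hl hq] at hd
    rw [mem_sigma, Nat.mem_divisorsAntidiagonal]
    exact ⟨⟨Nat.mul_div_cancel' hd.1, (Nat.mul_pos (hq 0) hl).ne'⟩, hd.2⟩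
  · rintro ⟨⟨a, r⟩, d⟩ h
    rw [mem_sigma, Nat.mem_divisorsAntidiagonal] at h
    obtain ⟨⟨h1, h2⟩, h3⟩ := h
    simp only at h1 h2 h3
    rw [mem_divTuples_succ hb hl hq]
    simp only [Fin.cons_zero, Fin.tail_cons]
    have ha : 0 < a := Nat.pos_of_ne_zero fun h => h2 (by rw [← h1, h, zero_mul])
    rw [← h1, Nat.mul_div_cancel_left _ ha]
    exact ⟨dvd_mul_right _ _, h3⟩
  · simp
  · rintro ⟨⟨a, r⟩, d⟩ h
    rw [mem_sigma, Nat.mem_divisorsAntidiagonal] at h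
    obtain ⟨⟨h1, h2⟩, h3⟩ := h
    simp only at h1 h2 h3
    have ha : 0 < a := Nat.pos_of_ne_zero fun h => h2 (by rw [← h1, h, zero_mul])
    simp only [Fin.cons_zero, Fin.tail_cons]
    rw [← h1, Nat.mul_div_cancel_left _ ha]
  · simp

/-- On `divTuples b (b l) q` every level is a multiple of `b`. -/
lemma level_mul {k b l : ℕ} (hb : 0 < b) (hl : 0 < l) {q d : Fin k → ℕ}
    (hq : ∀ i, 0 < q i) (hd : d ∈ divTuples b (b * l) q) (i : Fin (k + 1)) :
    level (b * l) q d i = b * level l q d i ∧ 0 < level l q d i := by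
  induction k generalizing l with
  | zero => simpa [Fin.fin_one_eq_zero i] using hl
  | succ k ih =>
    cases i using Fin.cases with
    | zero => simpa using hl
    | succ i =>
      obtain ⟨⟨r, hr⟩, h2⟩ := (mem_divTuples_succ hb hl hq).1 hd
      have hd0 := pos_of_mem_divTuples hd 0
      rw [hr, Nat.mul_div_cancel_left _ hd0] at h2
      have hpos : 0 < d 0 * r := hr ▸ Nat.mul_pos (hq 0) hl
      have hr' : d 0 * (b * r) = q 0 * (b * l) := by
        rw [mul_left_comm, ← hr, mul_left_comm]
      rw [level_succ hr' hd0, level_succ hr.symm hd0]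
      exact ih (Nat.pos_of_mul_pos_left hpos) (fun i => hq i.succ) h2 i

lemma cpow_natCast_eq_exp {n : ℕ} (hn : 0 < n) (z : ℂ) :
    (n : ℂ) ^ z = Complex.exp (Complex.log n * z) :=
  Complex.cpow_def_of_ne_zero (by exact_mod_cast hn.ne') z

/-- Splitting off the first entries, with `r = q₁ c / d₁` as the new modulus. -/
lemma weight_succ {k c r : ℕ} {q d : Fin (k + 1) → ℕ} (hc : 0 < c) (hr : 0 < r)
    (hd : 0 < d 0) (hq : 0 < q 0) (h : d 0 * r = q 0 * c) (s : ℂ) :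
    weight c q d s = weight r (Fin.tail q) (Fin.tail d) s * ((q 0 : ℂ) ^ (s - 1) *
      (c : ℂ) ^ (-s)) := by
  have hlog : Complex.log (d 0 : ℂ) + Complex.log r = Complex.log (q 0 : ℂ) + Complex.log c := by
    rw [← Complex.natCast_log, ← Complex.natCast_log, ← Complex.natCast_log, ← Complex.natCast_log,
      ← Complex.ofReal_add, ← Complex.ofReal_add, ← Real.log_mul (by positivity) (by positivity),
      ← Real.log_mul (by positivity) (by positivity)]
    exact_mod_cast congrArg (fun x : ℕ => ((Real.log (x : ℝ) : ℝ) : ℂ)) h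
  have key : (d 0 : ℂ) ^ (((k + 1 + 1 : ℕ) : ℂ) * s) * (r : ℂ) ^ (((k + 2 : ℕ) : ℂ) * s - 1) =
      (c : ℂ) ^ (((k + 1 + 2 : ℕ) : ℂ) * s - 1) * (d 0 : ℂ) *
        (q 0 : ℂ) ^ (((k + 1 : ℕ) : ℂ) * s) * ((q 0 : ℂ) ^ (s - 1) * (c : ℂ) ^ (-s)) := by
    have hd1 : (d 0 : ℂ) = Complex.exp (Complex.log (d 0 : ℂ)) :=
      (Complex.exp_log (by exact_mod_cast hd.ne')).symm
    conv_rhs => rw [hd1]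
    simp only [cpow_natCast_eq_exp hd, cpow_natCast_eq_exp hr, cpow_natCast_eq_exp hc,
      cpow_natCast_eq_exp hq, ← Complex.exp_add]
    congr 1
    have : Complex.log (r : ℂ) = Complex.log (q 0 : ℂ) + Complex.log c - Complex.log (d 0 : ℂ) := by
      rw [← hlog]; ring
    rw [this]
    push_cast
    ring
  have hne : ∀ (n : ℕ) (z : ℂ), 0 < n → (n : ℂ) ^ z ≠ 0 := by
    intro n z hn
    rw [cpow_natCast_eq_exp hn]
    exact Complex.exp_ne_zero _
  have hd' : (d 0 : ℂ) ≠ 0 := by exact_mod_cast hd.ne'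
  have h1 := hne r (((k + 2 : ℕ) : ℂ) * s - 1) hr
  have h2 := hne c (((k + 1 + 2 : ℕ) : ℂ) * s - 1) hc
  have h3 := hne (q 0) (((k + 1 : ℕ) : ℂ) * s) hq
  simp only [weight, Fin.prod_univ_succ, Fin.val_zero, Fin.val_succ, Nat.sub_zero,
    Nat.add_sub_add_right, Fin.tail]
  generalize ∏ i : Fin k, (d i.succ : ℂ) ^ (((k + 1 - i.val : ℕ) : ℂ) * s) = X at *
  generalize ∏ i : Fin k, (d i.succ : ℂ) = X2 at *
  generalize ∏ i : Fin k, (q i.succ : ℂ) ^ (((k - i.val : ℕ) : ℂ) * s) = X3 at *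
  rw [div_mul_eq_mul_div]
  rcases eq_or_ne X2 0 with rfl | hX2
  · simp
  rcases eq_or_ne X3 0 with rfl | hX3
  · simp
  rw [div_eq_div_iff (by positivity) (by positivity)]
  linear_combination (X * X2 * X3) * key

/-- The weight in terms of the levels `r₀, …, r_{N-2}`. -/
lemma weight_eq {k b l : ℕ} (hb : 0 < b) (hl : 0 < l) {q d : Fin k → ℕ}
    (hq : ∀ i, 0 < q i) (hd : d ∈ divTuples b (b * l) q) (s : ℂ) :
    weight (b * l) q d s = ((b * l : ℕ) : ℂ) ^ (1 - s) * (b : ℂ) ^ (-((k + 1 : ℕ) * s)) *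
      ((∏ i : Fin k, (d i : ℂ) ^ (s - 1) * (level l q d i.castSucc : ℂ) ^ (-s)) *
        (level l q d (Fin.last k) : ℂ) ^ (-s)) := by
  induction k generalizing l with
  | zero =>
    have hbl := Nat.mul_pos hb hl
    simp only [weight, univ_eq_empty, prod_empty, mul_one, one_mul, one_div]
    rw [show Fin.last 0 = 0 from rfl, level_zero, ← Complex.cpow_neg, mul_assoc]
    have : (b : ℂ) ^ (-(((0 + 1 : ℕ) : ℂ) * s)) * (l : ℂ) ^ (-s) = ((b * l : ℕ) : ℂ) ^ (-s) := by
      rw [Nat.cast_mul, Complex.natCast_mul_natCast_cpow]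
      simp
    rw [this, ← Complex.cpow_add _ _ (by exact_mod_cast hbl.ne')]
    congr 1
    push_cast
    ring
  | succ k ih =>
    obtain ⟨⟨r, hr⟩, h2⟩ := (mem_divTuples_succ hb hl hq).1 hd
    have hd0 := pos_of_mem_divTuples hd 0
    rw [hr, Nat.mul_div_cancel_left _ hd0] at h2
    have hpos : 0 < d 0 * r := hr ▸ Nat.mul_pos (hq 0) hl
    have hr0 := Nat.pos_of_mul_pos_left hpos
    have hr' : d 0 * (b * r) = q 0 * (b * l) := by
      rw [mul_left_comm, ← hr, mul_left_comm]
    rw [weight_succ (Nat.mul_pos hb hl) (Nat.mul_pos hb hr0) hd0 (hq 0) hr',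
      ih (q := Fin.tail q) hr0 (fun i => hq i.succ) h2, Fin.prod_univ_succ, Fin.castSucc_zero, level_zero,
      ← Fin.succ_last, level_succ hr.symm hd0]
    simp only [← Fin.succ_castSucc, level_succ hr.symm hd0]
    rw [show ∏ i : Fin k, (Fin.tail d i : ℂ) ^ (s - 1) *
      (level r (Fin.tail q) (Fin.tail d) i.castSucc : ℂ) ^ (-s) = ∏ i : Fin k,
      (d i.succ : ℂ) ^ (s - 1) * (level r (Fin.tail q) (Fin.tail d) i.castSucc : ℂ) ^ (-s) from rfl]
    generalize ∏ i : Fin k, (d i.succ : ℂ) ^ (s - 1) *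
      (level r (Fin.tail q) (Fin.tail d) i.castSucc : ℂ) ^ (-s) = X
    generalize (level r (Fin.tail q) (Fin.tail d) (Fin.last k) : ℂ) ^ (-s) = X2
    have hq1 : ((d 0 : ℂ) ^ (s - 1)) * ((b * r : ℕ) : ℂ) ^ (s - 1) =
        (q 0 : ℂ) ^ (s - 1) * ((b * l : ℕ) : ℂ) ^ (s - 1) := by
      rw [← Complex.natCast_mul_natCast_cpow, ← Complex.natCast_mul_natCast_cpow]
      exact_mod_cast congrArg (fun n : ℕ => (n : ℂ) ^ (s - 1)) hr'
    have hinv : ∀ n : ℕ, 0 < n → (n : ℂ) ^ (1 - s) * (n : ℂ) ^ (s - 1) = 1 := by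
      intro n hn
      rw [← Complex.cpow_add _ _ (by exact_mod_cast hn.ne'), sub_add_sub_cancel, sub_self,
        Complex.cpow_zero]
    have h1 := hinv (b * r) (Nat.mul_pos hb hr0)
    have h3 := hinv (b * l) (Nat.mul_pos hb hl)
    have h4 : ((b * l : ℕ) : ℂ) ^ (-s) = (b : ℂ) ^ (-s) * (l : ℂ) ^ (-s) := by
      rw [Nat.cast_mul, Complex.natCast_mul_natCast_cpow]
    have h5 : (b : ℂ) ^ (-(((k + 1 + 1 : ℕ) : ℂ) * s)) =
        (b : ℂ) ^ (-(((k + 1 : ℕ) : ℂ) * s)) * (b : ℂ) ^ (-s) := by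
      rw [← Complex.cpow_add _ _ (by exact_mod_cast hb.ne')]
      congr 1
      push_cast
      ring
    rw [h4, h5]
    have h6 : ((b * r : ℕ) : ℂ) ^ (1 - s) * (q 0 : ℂ) ^ (s - 1) =
        ((b * l : ℕ) : ℂ) ^ (1 - s) * (d 0 : ℂ) ^ (s - 1) := by
      linear_combination (d 0 : ℂ) ^ (s - 1) * ((b * l : ℕ) : ℂ) ^ (1 - s) * h1 -
        (q 0 : ℂ) ^ (s - 1) * ((b * r : ℕ) : ℂ) ^ (1 - s) * h3 -
        ((b * l : ℕ) : ℂ) ^ (1 - s) * ((b * r : ℕ) : ℂ) ^ (1 - s) * hq1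
    linear_combination (b : ℂ) ^ (-(((k + 1 : ℕ) : ℂ) * s)) * X * X2 *
      (b : ℂ) ^ (-s) * (l : ℂ) ^ (-s) * h6

/-- A Dirichlet series with Gauss sums as coefficients in terms of series twisted by the
conjugate primitive character. -/
lemma LSeries_mul_gauss {b l : ℕ} [NeZero b] (hl : 0 < l) {χ : DirichletCharacter ℂ b}
    (hχ : χ.IsPrimitive) (f : ℕ → ℂ) (s : ℂ)
    (hf : ∀ p ∈ l.divisorsAntidiagonal,
      LSeriesSummable (fun n => f (n * p.2) * χ⁻¹ (n : ZMod b)) s) :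
    LSeries (fun n => f n * gauss χ (b * l) n) s = gauss χ b 1 *
      ∑ p ∈ l.divisorsAntidiagonal, (ArithmeticFunction.moebius p.1 : ℂ) * χ (p.1 : ZMod b) *
        ((p.2 : ℂ) ^ (1 - s) * LSeries (fun n => f (n * p.2) * χ⁻¹ (n : ZMod b)) s) := by
  have hpos : ∀ p ∈ l.divisorsAntidiagonal, 0 < p.2 := fun p hp =>
    Nat.pos_of_ne_zero (Nat.ne_zero_of_mem_divisorsAntidiagonal hp).2
  have h1 : LSeries (fun n => f n * gauss χ (b * l) n) s =
      LSeries (∑ p ∈ l.divisorsAntidiagonal,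
        (gauss χ b 1 * ((ArithmeticFunction.moebius p.1 : ℂ) * χ (p.1 : ZMod b) * p.2)) •
          fun n => if p.2 ∣ n then
            (fun n => f (n * p.2) * χ⁻¹ (n : ZMod b)) (n / p.2) else 0) s := by
    refine LSeries_congr (fun {n} _ => ?_) s
    rw [gauss_mul_eq hl hχ, Finset.sum_apply, mul_sum, mul_sum]
    refine sum_congr rfl fun p hp => ?_
    simp only [Pi.smul_apply, smul_eq_mul]
    split_ifs with h
    · rw [Nat.div_mul_cancel h]
      ring
    · simp
  rw [h1, LSeries_sum fun p hp => (LSeriesSummable_dilate (hpos p hp) (hf p hp)).smul _, mul_sum]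
  refine sum_congr rfl fun p hp => ?_
  rw [LSeries_smul, LSeries_dilate (hpos p hp) (fun n => f (n * p.2) * χ⁻¹ (n : ZMod b)),
    sub_eq_add_neg, Complex.cpow_add _ _ (by exact_mod_cast (hpos p hp).ne'), Complex.cpow_one]
  ring

lemma sum_divisorsAntidiagonal_dvd {M : Type*} [AddCommMonoid M] {a P : ℕ} (hP : 0 < P)
    (F : ℕ → ℕ → M) :
    ∑ r ∈ (a * P).divisorsAntidiagonal, (if P ∣ r.1 then F r.1 r.2 else 0) =
      ∑ r ∈ a.divisorsAntidiagonal, F (P * r.1) r.2 := by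
  rw [← sum_filter]
  refine sum_nbij' (fun r => (r.1 / P, r.2)) (fun r => (P * r.1, r.2)) ?_ ?_ ?_ ?_ ?_
  · rintro ⟨x, y⟩ h
    rw [mem_filter, Nat.mem_divisorsAntidiagonal] at h
    obtain ⟨⟨h1, h2⟩, z, rfl⟩ := h
    simp only at h1
    rw [Nat.mem_divisorsAntidiagonal]
    simp only [Nat.mul_div_cancel_left _ hP]
    refine ⟨Nat.eq_of_mul_eq_mul_left hP ?_, left_ne_zero_of_mul h2⟩
    rw [← mul_assoc, h1, mul_comm]
  · rintro ⟨x, y⟩ h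
    rw [Nat.mem_divisorsAntidiagonal] at h
    rw [mem_filter, Nat.mem_divisorsAntidiagonal, ← h.1]
    refine ⟨⟨by simp only; ring, mul_ne_zero (h.1 ▸ h.2) hP.ne'⟩, dvd_mul_right _ _⟩
  · rintro ⟨x, y⟩ h
    rw [mem_filter] at h
    simp only [Nat.mul_div_cancel' h.2]
  · rintro ⟨x, y⟩ h
    simp only [Nat.mul_div_cancel_left _ hP]
  · rintro ⟨x, y⟩ h
    rw [mem_filter] at h
    simp only [Nat.mul_div_cancel' h.2]

/-- Evaluating all Gauss sums on the right side of the Voronoi formula gives `splitSum`. -/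
lemma sum_divTuples_gauss {k b l : ℕ} [NeZero b] (hl : 0 < l) {χ : DirichletCharacter ℂ b}
    (hχ : χ.IsPrimitive) {q : Fin k → ℕ} (hq : ∀ i, 0 < q i) (D : (Fin (k + 1) → ℕ) → ℂ) (s : ℂ) :
    ∑ d ∈ divTuples b (b * l) q,
      (∏ i : Fin k, gauss χ (b * level l q d i.castSucc) (d i) *
        ((d i : ℂ) ^ (s - 1) * (level l q d i.castSucc : ℂ) ^ (-s))) *
      ((level l q d (Fin.last k) : ℂ) ^ (-s) * (gauss χ b 1 *
        ∑ p ∈ (level l q d (Fin.last k)).divisorsAntidiagonal,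
          (ArithmeticFunction.moebius p.1 : ℂ) * χ (p.1 : ZMod b) *
            ((p.2 : ℂ) ^ s * D (Fin.snoc d p.2)))) =
    gauss χ b 1 ^ (k + 1) *
      splitSum (fun a => (ArithmeticFunction.moebius a : ℂ) * charWeight χ s a)
        (charWeight χ⁻¹ (1 - s)) k D l q := by
  have hb : 0 < b := NeZero.pos b
  have hsplit : ∀ n : ℕ, ∀ p ∈ n.divisorsAntidiagonal,
      (n : ℂ) ^ (-s) * (p.2 : ℂ) ^ s = (p.1 : ℂ) ^ (-s) := by
    intro n p hp
    obtain ⟨rfl, hn⟩ := Nat.mem_divisorsAntidiagonal.1 hp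
    have h2 : (p.2 : ℂ) ≠ 0 := by exact_mod_cast right_ne_zero_of_mul hn
    rw [Nat.cast_mul, Complex.natCast_mul_natCast_cpow, mul_assoc, ← Complex.cpow_add _ _ h2,
      neg_add_cancel, Complex.cpow_zero, mul_one]
  induction k generalizing l with
  | zero =>
    have hdiv : divTuples b (b * l) q = {q} := by
      ext d
      rw [mem_divTuples (Nat.mul_pos hb hl) hq, mem_singleton]
      exact ⟨fun _ => Subsingleton.elim _ _, fun _ i => i.elim0⟩
    rw [hdiv, sum_singleton, show Fin.last 0 = 0 from rfl, level_zero]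
    simp only [univ_eq_empty, prod_empty, one_mul, splitSum, zero_add, pow_one]
    rw [mul_left_comm, mul_sum]
    congr 1
    refine sum_congr rfl fun p hp => ?_
    have hD : (Fin.snoc q p.2 : Fin 1 → ℕ) = fun _ => p.2 := by
      funext i
      rw [Fin.fin_one_eq_zero i]
      simp [Fin.snoc]
    rw [hD, charWeight, ← hsplit l p hp]
    ring
  | succ k ih =>
    rw [sum_divTuples_succ hb hl hq]
    have hstep : ∀ r ∈ (q 0 * l).divisorsAntidiagonal,
        ∑ d ∈ divTuples b (b * r.2) (Fin.tail q),
          (∏ i : Fin (k + 1), gauss χ (b * level l q (Fin.cons r.1 d) i.castSucc)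
              ((Fin.cons r.1 d : Fin (k + 1) → ℕ) i) *
            (((Fin.cons r.1 d : Fin (k + 1) → ℕ) i : ℂ) ^ (s - 1) *
              (level l q (Fin.cons r.1 d) i.castSucc : ℂ) ^ (-s))) *
          ((level l q (Fin.cons r.1 d) (Fin.last (k + 1)) : ℂ) ^ (-s) * (gauss χ b 1 *
            ∑ p ∈ (level l q (Fin.cons r.1 d) (Fin.last (k + 1))).divisorsAntidiagonal,
              (ArithmeticFunction.moebius p.1 : ℂ) * χ (p.1 : ZMod b) *
                ((p.2 : ℂ) ^ s * D (Fin.snoc (Fin.cons r.1 d : Fin (k + 1) → ℕ) p.2)))) =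
        gauss χ (b * l) r.1 * ((r.1 : ℂ) ^ (s - 1) * (l : ℂ) ^ (-s)) * (gauss χ b 1 ^ (k + 1) *
          splitSum (fun a => (ArithmeticFunction.moebius a : ℂ) * charWeight χ s a)
            (charWeight χ⁻¹ (1 - s)) k (fun m => D (Fin.cons r.1 m)) r.2 (Fin.tail q)) := by
      intro r hr
      have hr0 := Nat.ne_zero_of_mem_divisorsAntidiagonal hr
      have hr1 := Nat.pos_of_ne_zero hr0.1
      have hr2 := (Nat.mem_divisorsAntidiagonal.1 hr).1
      rw [← ih (q := Fin.tail q) (Nat.pos_of_ne_zero hr0.2) (fun i => hq i.succ), mul_sum]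
      refine sum_congr rfl fun d _ => ?_
      have hlev : ∀ i, level l q (Fin.cons r.1 d) (Fin.succ i) = level r.2 (Fin.tail q) d i :=
        fun i => level_succ (by simpa using hr2) (by simpa using hr1) i
      rw [Fin.prod_univ_succ, Fin.castSucc_zero, level_zero, ← Fin.succ_last]
      simp only [← Fin.succ_castSucc, hlev, Fin.cons_zero, Fin.cons_succ,
        ← Fin.cons_snoc_eq_snoc_cons]
      ring
    rw [sum_congr rfl hstep]
    simp only [splitSum]
    have hgauss : ∀ r ∈ (q 0 * l).divisorsAntidiagonal, gauss χ (b * l) r.1 *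
        ((r.1 : ℂ) ^ (s - 1) * (l : ℂ) ^ (-s)) * (gauss χ b 1 ^ (k + 1) *
          splitSum (fun a => (ArithmeticFunction.moebius a : ℂ) * charWeight χ s a)
            (charWeight χ⁻¹ (1 - s)) k (fun m => D (Fin.cons r.1 m)) r.2 (Fin.tail q)) =
        gauss χ b 1 ^ (k + 1 + 1) * ∑ p ∈ l.divisorsAntidiagonal, if p.2 ∣ r.1 then
          (ArithmeticFunction.moebius p.1 : ℂ) * χ (p.1 : ZMod b) *
          (p.2 * χ⁻¹ ((r.1 / p.2 : ℕ) : ZMod b)) * ((r.1 : ℂ) ^ (s - 1) * (l : ℂ) ^ (-s)) *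
          splitSum (fun a => (ArithmeticFunction.moebius a : ℂ) * charWeight χ s a)
            (charWeight χ⁻¹ (1 - s)) k (fun m => D (Fin.cons r.1 m)) r.2 (Fin.tail q)
          else 0 := by
      intro r _
      rw [gauss_mul_eq hl hχ, pow_succ' _ (k + 1)]
      simp only [mul_sum, sum_mul]
      refine sum_congr rfl fun p _ => ?_
      split_ifs
      · ring
      · simp
    rw [sum_congr rfl hgauss, ← mul_sum, sum_comm]
    congr 1
    refine sum_congr rfl fun p hp => ?_
    have hp0 := Nat.ne_zero_of_mem_divisorsAntidiagonal hp
    have hp2 := Nat.pos_of_ne_zero hp0.2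
    have hl' := (Nat.mem_divisorsAntidiagonal.1 hp).1
    have hql : q 0 * l = q 0 * p.1 * p.2 := by rw [mul_assoc, hl']
    rw [hql, sum_divisorsAntidiagonal_dvd hp2 fun x y =>
      (ArithmeticFunction.moebius p.1 : ℂ) * χ (p.1 : ZMod b) *
          (p.2 * χ⁻¹ ((x / p.2 : ℕ) : ZMod b)) * ((x : ℂ) ^ (s - 1) * (l : ℂ) ^ (-s)) *
          splitSum (fun a => (ArithmeticFunction.moebius a : ℂ) * charWeight χ s a)
            (charWeight χ⁻¹ (1 - s)) k (fun m => D (Fin.cons x m)) y (Fin.tail q), mul_sum]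
    refine sum_congr rfl fun r _ => ?_
    have h1 : (p.2 : ℂ) * (p.2 : ℂ) ^ (s - 1) = (p.2 : ℂ) ^ s := by
      have : (p.2 : ℂ) ≠ 0 := by exact_mod_cast hp0.2
      rw [Complex.cpow_sub _ _ this, Complex.cpow_one]
      field_simp
    rw [Nat.mul_div_cancel_left _ hp2, Nat.cast_mul p.2, Complex.natCast_mul_natCast_cpow,
      charWeight, charWeight, ← hsplit l p hp, ← h1, neg_sub]
    ring

/-! ### The Voronoi formula with Gauss sums -/

/-- The sum over the chains `e₁ ∣ f, e₂ ∣ q₁ e₁, …, e_{N-1} ∣ q_{N-2} e_{N-2}` of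
`μ(e₁) Y(e₁) ⋯ μ(e_{N-1}) Y(e_{N-1}) A(q_{N-2} e_{N-2} / e_{N-1}, …, q₁ e₁ / e₂, f / e₁)` with
`Y(n) = χ(n) n^{-s}`: the finite factor by which `∑ A(q_{N-2}, …, q₁, f n) χ(n) n^{-s}` differs from
`L(s, F × χ)`. -/
noncomputable def chainFactor {k b : ℕ} (A : (Fin (k + 1) → ℕ) → ℂ) (q : Fin k → ℕ)
    (χ : DirichletCharacter ℂ b) (f : ℕ) (s : ℂ) : ℂ :=
  chainSum (fun a => (ArithmeticFunction.moebius a : ℂ) * charWeight χ s a) (k + 1) (dual A) 1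
    (Fin.cons f q)

lemma differentiable_natCast_cpow {n : ℕ} (hn : n ≠ 0) {g : ℂ → ℂ} (hg : Differentiable ℂ g) :
    Differentiable ℂ fun s => (n : ℂ) ^ g s := by
  have : (n : ℂ) ≠ 0 := by exact_mod_cast hn
  exact fun s => (hg s).const_cpow (Or.inl this)

lemma differentiable_chainFactor {k b : ℕ} (A : (Fin (k + 1) → ℕ) → ℂ) (q : Fin k → ℕ)
    (χ : DirichletCharacter ℂ b) (f : ℕ) : Differentiable ℂ (chainFactor A q χ f) := by
  refine differentiable_chainSum
    (fun s a => (ArithmeticFunction.moebius a : ℂ) * charWeight χ s a) (fun a => ?_) _ _ _ _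
  rcases eq_or_ne a 0 with rfl | ha
  · simp
  · exact (differentiable_const _).mul ((differentiable_const _).mul
      (differentiable_natCast_cpow ha differentiable_neg))

lemma cons_pos {k f : ℕ} (hf : 0 < f) {q : Fin k → ℕ} (hq : ∀ i, 0 < q i) (i : Fin (k + 1)) :
    0 < (Fin.cons f q : Fin (k + 1) → ℕ) i := by
  cases i using Fin.cases with
  | zero => exact hf
  | succ i => exact hq i

/-- `∑ A(q_{N-2}, …, q₁, f n) χ(n) n^{-s}` is `L(s, F × χ)` times a Dirichlet polynomial. -/
lemma headSeries_cons {k b : ℕ} {A : (Fin (k + 1) → ℕ) → ℂ} (hecke : HeckeRelations A) {σ : ℝ}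
    (growth : ModerateGrowth A σ) (χ : DirichletCharacter ℂ b) {s : ℂ} (hs : 1 + σ < s.re)
    {q : Fin k → ℕ} (hq : ∀ i, 0 < q i) {f : ℕ} (hf : 0 < f) :
    headSeries (dual A) χ s (Fin.cons f q) =
      LSeries (twistedCoeff A χ) s * chainFactor A q χ f s := by
  have h := chainSum_heckeSum (charWeight_one χ s) (charWeight_mul χ s) (k + 1)
    (headSeries (dual A) χ s) 1 (Fin.cons f q) one_pos (cons_pos hf hq)
  rw [mul_one, mulHead_one] at h
  rw [← h, chainFactor, ← chainSum_const_mul]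
  exact chainSum_congr _ _ (fun m hm => (LSeries_mul_dual hecke growth χ hs m hm).symm) _ _
    (cons_pos hf hq)

/-- The dual counterpart of `headSeries_cons`. -/
lemma LSeries_mul_chainFactor {k b : ℕ} {A : (Fin (k + 1) → ℕ) → ℂ} (hecke : HeckeRelations A)
    {σ : ℝ} (growth : ModerateGrowth A σ) (χ : DirichletCharacter ℂ b) {s : ℂ}
    (hs : s.re < -σ) {q : Fin k → ℕ} (hq : ∀ i, 0 < q i) {f : ℕ} (hf : 0 < f) :
    LSeries (twistedCoeff (dual A) χ⁻¹) (1 - s) * chainFactor A q χ f s =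
      ∑ p ∈ f.divisorsAntidiagonal, charWeight χ⁻¹ (1 - s) p.1 *
        splitSum (fun a => (ArithmeticFunction.moebius a : ℂ) * charWeight χ s a)
          (charWeight χ⁻¹ (1 - s)) k (lastSeries (dual A) χ⁻¹ (1 - s)) p.2 q := by
  rw [sum_splitSum, chainFactor, ← chainSum_const_mul]
  refine chainSum_congr _ _ (fun m hm => ?_) _ _ (cons_pos hf hq)
  exact LSeries_dual_mul_dual hecke growth χ⁻¹ (by simp; linarith) m hm

lemma cons_mul_eq_mulHead {k : ℕ} (q : Fin k → ℕ) (n f : ℕ) :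
    (Fin.cons (n * f) q : Fin (k + 1) → ℕ) = mulHead n (Fin.cons f q) := by
  rw [mulHead_succ, Fin.cons_zero, Fin.tail_cons]

lemma snoc_mul_eq_mulLast {k : ℕ} (d : Fin k → ℕ) (n f : ℕ) :
    (Fin.snoc d (n * f) : Fin (k + 1) → ℕ) = mulLast n (Fin.snoc d f) := by
  funext i
  cases i using Fin.lastCases <;> simp [mulLast, Fin.castSucc_ne_last]

lemma startTuple_eq {k : ℕ} (A : (Fin (k + 1) → ℕ) → ℂ) (d : Fin k → ℕ) (n : ℕ) :
    A (startTuple n d) = dual A (Fin.snoc d n) := by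
  rw [dual]
  congr 1
  funext i
  cases i using Fin.cases with
  | zero => simp [startTuple]
  | succ i => rw [Fin.rev_succ, Fin.snoc_castSucc, startTuple, Fin.cons_succ]

lemma snoc_pos {k f : ℕ} (hf : 0 < f) {d : Fin k → ℕ} (hd : ∀ i, 0 < d i) (i : Fin (k + 1)) :
    0 < (Fin.snoc d f : Fin (k + 1) → ℕ) i := by
  cases i using Fin.lastCases with
  | last => simpa using hf
  | cast i => simpa using hd i

lemma norm_e (x : ℝ) : ‖e x‖ = 1 := by
  rw [e, show (2 * Real.pi * Complex.I * x : ℂ) = ((2 * Real.pi * x : ℝ) : ℂ) * Complex.I by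
    push_cast; ring]
  exact Complex.norm_exp_ofReal_mul_I _

lemma norm_gauss_le {b : ℕ} (χ : DirichletCharacter ℂ b) (c : ℕ) (m : ℤ) :
    ‖gauss χ c m‖ ≤ c := by
  rw [gauss]
  refine (norm_sum_le _ _).trans ?_
  calc ∑ u ∈ range c with u.Coprime c, ‖χ (u : ZMod b) * e ((m : ℝ) * u / c)‖
      ≤ ∑ u ∈ range c with u.Coprime c, 1 := by
        refine sum_le_sum fun u _ => ?_
        rw [norm_mul, norm_e, mul_one]
        exact dirichletChar_norm_le χ u
    _ ≤ c := by
        rw [sum_const, nsmul_eq_mul, mul_one]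
        exact_mod_cast (card_filter_le _ _).trans (card_range c).le

lemma summable_endTuple {k : ℕ} {A : (Fin (k + 1) → ℕ) → ℂ} {σ : ℝ} (growth : ModerateGrowth A σ)
    {q : Fin k → ℕ} (hq : ∀ i, 0 < q i) {b : ℕ → ℂ} {K : ℝ} (hb : ∀ n, ‖b n‖ ≤ K) {s : ℂ}
    (hs : 1 + σ < s.re) : LSeriesSummable (fun n => A (endTuple q n) * b n) s := by
  refine growth.dual.summable (g := fun n => Fin.cons n q) (P := ∏ i, q i) (fun n hn => ?_) hb hs
  exact ⟨cons_pos (Nat.pos_of_ne_zero hn) hq, by rw [Fin.prod_univ_succ]; simp⟩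

lemma summable_startTuple {k : ℕ} {A : (Fin (k + 1) → ℕ) → ℂ} {σ : ℝ}
    (growth : ModerateGrowth A σ)
    {d : Fin k → ℕ} (hd : ∀ i, 0 < d i) {b : ℕ → ℂ} {K : ℝ} (hb : ∀ n, ‖b n‖ ≤ K) {s : ℂ}
    (hs : s.re < -σ) : LSeriesSummable (fun n => A (startTuple n d) * b n) (1 - s) := by
  simp only [startTuple_eq]
  refine growth.dual.summable (g := fun n => Fin.snoc d n) (P := ∏ i, d i) (fun n hn => ?_) hb
    (by simp; linarith)
  exact ⟨snoc_pos (Nat.pos_of_ne_zero hn) hd, by rw [Fin.prod_univ_castSucc]; simp [mul_comm]⟩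

/-- The numerator of `H(q; c, χ, s)` as a finite multiple of `L(s, F × χ)`. -/
lemma LSeries_hCoeff {k b l : ℕ} [NeZero b] {A : (Fin (k + 1) → ℕ) → ℂ} (hecke : HeckeRelations A)
    {σ : ℝ} (growth : ModerateGrowth A σ) {χ : DirichletCharacter ℂ b} (hχ : χ.IsPrimitive) {s : ℂ}
    (hs : 1 + σ < s.re) {q : Fin k → ℕ} (hq : ∀ i, 0 < q i) (hl : 0 < l) :
    LSeries (hCoeff A q (b * l) χ) s = gauss χ⁻¹ b 1 * LSeries (twistedCoeff A χ) s *
      ∑ p ∈ l.divisorsAntidiagonal, (ArithmeticFunction.moebius p.1 : ℂ) * χ⁻¹ (p.1 : ZMod b) *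
        ((p.2 : ℂ) ^ (1 - s) * chainFactor A q χ p.2 s) := by
  have hseries : ∀ p : ℕ × ℕ, (fun n => A (endTuple q (n * p.2)) * χ⁻¹⁻¹ (n : ZMod b)) =
      fun n => dual A (mulHead n (Fin.cons p.2 q)) * χ (n : ZMod b) := by
    intro p
    funext n
    rw [inv_inv, ← cons_mul_eq_mulHead]
    rfl
  have hpos : ∀ p ∈ l.divisorsAntidiagonal, 0 < p.2 := fun p hp =>
    Nat.pos_of_ne_zero (Nat.ne_zero_of_mem_divisorsAntidiagonal hp).2
  have h := LSeries_mul_gauss hl (isPrimitive_inv hχ) (fun n => A (endTuple q n)) s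
    (fun p hp => by
      rw [hseries]
      exact growth.dual.summable (fun n hn => mulHead_pos hn (cons_pos (hpos p hp) hq))
        (dirichletChar_norm_le χ) hs)
  rw [show hCoeff A q (b * l) χ = fun n => A (endTuple q n) * gauss χ⁻¹ (b * l) n from rfl, h,
    mul_assoc]
  congr 1
  rw [mul_sum]
  refine sum_congr rfl fun p hp => ?_
  have h2 := headSeries_cons hecke growth χ hs hq (hpos p hp)
  rw [headSeries] at h2
  rw [hseries, h2]
  ring

/-- `G(q; c, χ, s)` in terms of `splitSum`. -/
lemma gSeries_eq {k b l : ℕ} [NeZero b] {A : (Fin (k + 1) → ℕ) → ℂ} (Gp Gm : ℂ → ℂ)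
    {σ : ℝ} (growth : ModerateGrowth A σ) {χ : DirichletCharacter ℂ b} (hχ : χ.IsPrimitive) {s : ℂ}
    (hs : s.re < -σ) {q : Fin k → ℕ} (hq : ∀ i, 0 < q i) (hl : 0 < l) :
    gSeries A Gp Gm q (b * l) χ s = signFactor Gp Gm χ s * χ (-1) / (l : ℂ) ^ (1 - 2 * s) *
      (((b * l : ℕ) : ℂ) ^ (1 - s) * (b : ℂ) ^ (-((k + 1 : ℕ) * s)) * (gauss χ b 1 ^ (k + 1) *
      splitSum (fun a => (ArithmeticFunction.moebius a : ℂ) * charWeight χ s a)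
        (charWeight χ⁻¹ (1 - s)) k (lastSeries (dual A) χ⁻¹ (1 - s)) l q)) := by
  have hb : 0 < b := NeZero.pos b
  have hb' : (b : ℂ) ≠ 0 := by exact_mod_cast hb.ne'
  have hdiv : ((b * l : ℕ) : ℂ) / (b : ℂ) = l := by
    push_cast
    field_simp
  rw [gSeries, hdiv, ← sum_divTuples_gauss hl hχ hq, mul_sum (divTuples b (b * l) q)
    _ (((b * l : ℕ) : ℂ) ^ (1 - s) * (b : ℂ) ^ (-((k + 1 : ℕ) * s)))]
  congr 1
  refine sum_congr rfl fun d hd => ?_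
  have hlev := fun i => level_mul hb hl hq hd i
  have hd0 := pos_of_mem_divTuples hd
  have hseries : ∀ p : ℕ × ℕ, (fun n => A (startTuple (n * p.2) d) * χ⁻¹ (n : ZMod b)) =
      fun n => dual A (mulLast n (Fin.snoc d p.2)) * χ⁻¹ (n : ZMod b) := by
    intro p
    funext n
    rw [startTuple_eq A, ← snoc_mul_eq_mulLast]
  have hpos : ∀ p ∈ (level l q d (Fin.last k)).divisorsAntidiagonal, 0 < p.2 := fun p hp =>
    Nat.pos_of_ne_zero (Nat.ne_zero_of_mem_divisorsAntidiagonal hp).2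
  have h := LSeries_mul_gauss (hlev (Fin.last k)).2 hχ (fun n => A (startTuple n d)) (1 - s)
    (fun p hp => by
      rw [hseries]
      exact growth.dual.summable (fun n hn => mulLast_pos hn (snoc_pos (hpos p hp) hd0))
        (dirichletChar_norm_le χ⁻¹) (by simp; linarith))
  rw [show gCoeff A q d (b * l) χ = fun n => A (startTuple n d) *
    gauss χ (b * level l q d (Fin.last k)) n by
      funext n; rw [gCoeff, (hlev (Fin.last k)).1],
    h, weight_eq hb hl hq hd]
  simp only [(hlev _).1, hseries, sub_sub_cancel, prod_mul_distrib, lastSeries]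
  ring

/-- The Voronoi formula with Gauss sums. -/
theorem voronoi_gauss {k : ℕ} {A : (Fin (k + 1) → ℕ) → ℂ} {Gp Gm : ℂ → ℂ} {σ : ℝ}
    (hecke : HeckeRelations A) (growth : ModerateGrowth A σ)
    (hFE : TwistedFunctionalEquations A Gp Gm σ) (cstar c : ℕ) (χ : DirichletCharacter ℂ cstar)
    (q : Fin k → ℕ) (hc : 0 < c) (hcc : cstar ∣ c) (hχ : χ.IsPrimitive) (hq : ∀ i, 0 < q i) :
    ∃ E : ℂ → ℂ, Differentiable ℂ E ∧
      (∀ s : ℂ, 1 + σ < s.re →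
        LSeriesSummable (hCoeff A q c χ) s ∧ E s = hSeries A q c χ s) ∧
      (∀ s : ℂ, s.re < -σ →
        (∀ d ∈ divTuples cstar c q, LSeriesSummable (gCoeff A q d c χ) (1 - s)) ∧
        (AnalyticAt ℂ (signFactor Gp Gm χ) s → E s = gSeries A Gp Gm q c χ s)) := by
  obtain ⟨l, rfl⟩ := hcc
  have hb : 0 < cstar := Nat.pos_of_mul_pos_right hc
  have hl : 0 < l := Nat.pos_of_mul_pos_left hc
  have : NeZero cstar := ⟨hb.ne'⟩
  have hb' : (cstar : ℂ) ≠ 0 := by exact_mod_cast hb.ne'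
  have hl' : (l : ℂ) ≠ 0 := by exact_mod_cast hl.ne'
  have hpos : ∀ p ∈ l.divisorsAntidiagonal, 0 < p.2 := fun p hp =>
    Nat.pos_of_ne_zero (Nat.ne_zero_of_mem_divisorsAntidiagonal hp).2
  obtain ⟨Λ, hΛ, hΛ1, hΛ2⟩ := hFE cstar χ hb hχ
  refine ⟨fun s => (l : ℂ) ^ (-(1 - 2 * s)) * (gauss χ⁻¹ cstar 1 * Λ s *
    ∑ p ∈ l.divisorsAntidiagonal, (ArithmeticFunction.moebius p.1 : ℂ) * χ⁻¹ (p.1 : ZMod cstar) *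
        ((p.2 : ℂ) ^ (1 - s) * chainFactor A q χ p.2 s)), ?_, fun s hs => ⟨?_, ?_⟩,
    fun s hs => ⟨fun d hd => ?_, fun hG => ?_⟩⟩
  · refine (differentiable_natCast_cpow hl.ne' (by fun_prop)).mul
      (((differentiable_const _).mul hΛ).mul (Differentiable.fun_sum fun p hp => ?_))
    exact (differentiable_const _).mul ((differentiable_natCast_cpow (hpos p hp).ne'
      (by fun_prop)).mul (differentiable_chainFactor A q χ p.2))
  · exact summable_endTuple growth hq (fun n => norm_gauss_le χ⁻¹ _ n) hs
  · beta_reduce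
    rw [hSeries, LSeries_hCoeff hecke growth hχ hs hq hl, ← hΛ1 s (by linarith), Nat.cast_mul,
      mul_div_cancel_left₀ _ hb', Complex.cpow_neg]
    field_simp
  · exact summable_startTuple growth (pos_of_mem_divTuples hd)
      (fun n => norm_gauss_le χ _ n) hs
  · beta_reduce
    rw [gSeries_eq Gp Gm growth hχ hs hq hl, hΛ2 s hs hG]
    -- Möbius inversion in the first variable undoes the convolution in `sum_splitSum`.
    have key : LSeries (twistedCoeff (dual A) χ⁻¹) (1 - s) *
        ∑ p ∈ l.divisorsAntidiagonal, (ArithmeticFunction.moebius p.1 : ℂ) *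
          χ⁻¹ (p.1 : ZMod cstar) * ((p.2 : ℂ) ^ (1 - s) * chainFactor A q χ p.2 s) =
        (l : ℂ) ^ (1 - s) * splitSum (fun a => (ArithmeticFunction.moebius a : ℂ) *
          charWeight χ s a) (charWeight χ⁻¹ (1 - s)) k
            (lastSeries (dual A) χ⁻¹ (1 - s)) l q := by
      have h := sum_moebius_conv (Y := fun n => χ⁻¹ (n : ZMod cstar)) (by simp) (by simp) hl
        (fun _ b => (b : ℂ) ^ (1 - s) * splitSum (fun a => (ArithmeticFunction.moebius a : ℂ) *
          charWeight χ s a) (charWeight χ⁻¹ (1 - s)) k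
            (lastSeries (dual A) χ⁻¹ (1 - s)) b q)
      rw [← h, mul_sum]
      refine sum_congr rfl fun p hp => ?_
      rw [mul_left_comm, mul_left_comm (LSeries _ _),
        LSeries_mul_chainFactor hecke growth χ hs hq (hpos p hp), mul_sum, mul_sum]
      refine sum_congr rfl fun r hr => ?_
      obtain ⟨hr1, hr2⟩ := Nat.mem_divisorsAntidiagonal.1 hr
      have hr0 : (r.1 : ℂ) ≠ 0 := by
        exact_mod_cast (Nat.ne_zero_of_mem_divisorsAntidiagonal hr).1
      rw [← hr1, Nat.cast_mul, Complex.natCast_mul_natCast_cpow, charWeight]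
      have : (r.1 : ℂ) ^ (1 - s) * (r.1 : ℂ) ^ (-(1 - s)) = 1 := by
        rw [← Complex.cpow_add _ _ hr0, add_neg_cancel, Complex.cpow_zero]
      linear_combination (ArithmeticFunction.moebius p.1 : ℂ) * χ⁻¹ (p.1 : ZMod cstar) *
        χ⁻¹ (r.1 : ZMod cstar) * (r.2 : ℂ) ^ (1 - s) * splitSum (fun a =>
        (ArithmeticFunction.moebius a : ℂ) * charWeight χ s a) (charWeight χ⁻¹ (1 - s)) k
            (lastSeries (dual A) χ⁻¹ (1 - s)) r.2 q * this
    have hτ := gauss_inv_mul_gauss hχ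
    have hpow : (cstar : ℂ) * (cstar : ℂ) ^ (-(((k + 2 : ℕ) : ℂ) * s)) =
        (cstar : ℂ) ^ (1 - s) * (cstar : ℂ) ^ (-(((k + 1 : ℕ) : ℂ) * s)) := by
      rw [← Complex.cpow_add _ _ hb']
      nth_rewrite 1 [← Complex.cpow_one (cstar : ℂ)]
      rw [← Complex.cpow_add _ _ hb']
      congr 1
      push_cast
      ring
    rw [Nat.cast_mul, Complex.natCast_mul_natCast_cpow, div_eq_mul_inv, ← Complex.cpow_neg]
    generalize splitSum (fun a => (ArithmeticFunction.moebius a : ℂ) * charWeight χ s a)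
      (charWeight χ⁻¹ (1 - s)) k (lastSeries (dual A) χ⁻¹ (1 - s)) l q = S at key ⊢
    generalize ∑ p ∈ l.divisorsAntidiagonal, (ArithmeticFunction.moebius p.1 : ℂ) *
      χ⁻¹ (p.1 : ZMod cstar) * ((p.2 : ℂ) ^ (1 - s) * chainFactor A q χ p.2 s) = P at key ⊢
    calc _ = (l : ℂ) ^ (-(1 - 2 * s)) * signFactor Gp Gm χ s * gauss χ cstar 1 ^ (k + 1) *
          (gauss χ⁻¹ cstar 1 * gauss χ cstar 1) * (cstar : ℂ) ^ (-(((k + 2 : ℕ) : ℂ) * s)) *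
          (LSeries (twistedCoeff (dual A) χ⁻¹) (1 - s) * P) := by ring
      _ = (l : ℂ) ^ (-(1 - 2 * s)) * signFactor Gp Gm χ s * gauss χ cstar 1 ^ (k + 1) *
          χ (-1) * ((cstar : ℂ) * (cstar : ℂ) ^ (-(((k + 2 : ℕ) : ℂ) * s))) *
          ((l : ℂ) ^ (1 - s) * S) := by rw [hτ, key]; ring
      _ = _ := by rw [hpow]; ring

/-! ### Fourier transform of hyper-Kloosterman sums -/

/-- Summing over `x₁` last: a hyper-Kloosterman sum in terms of those of lower dimension with
modulus `r = q₁ c / d₁`. -/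
lemma hyperKloosterman_succ {k c r : ℕ} (a n : ℤ) {q d : Fin (k + 1) → ℕ}
    (h : d 0 * r = q 0 * c) (hd : 0 < d 0) :
    hyperKloosterman a n c q d = ∑ u ∈ range r with u.Coprime r,
      e (((d 0 * u : ℕ) : ℝ) * a / c) *
        hyperKloosterman (((u : ZMod r)⁻¹).val : ℤ) n r (Fin.tail q) (Fin.tail d) := by
  -- The inverse as a function of the modulus, so that moduli can be rewritten.
  let iv : ℕ → ℕ → ℤ := fun m x => (((x : ZMod m)⁻¹).val : ℤ)
  have hdef : ∀ {k : ℕ} (a : ℤ) (c : ℕ) (q d : Fin k → ℕ), hyperKloosterman a n c q d =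
      ∑ x ∈ Fintype.piFinset fun i : Fin k => (range (level c q d i.succ)).filter
        fun u => u.Coprime (level c q d i.succ),
      e ((∑ i : Fin k, (d i : ℝ) * (x i : ℝ) *
          ((Fin.cons a fun i => iv (level c q d i.succ) (x i) : Fin (k + 1) → ℤ) i.castSucc : ℝ) /
          (level c q d i.castSucc : ℝ)) +
        (n : ℝ) * ((Fin.cons a fun i => iv (level c q d i.succ) (x i) : Fin (k + 1) → ℤ)
          (Fin.last k) : ℝ) / (level c q d (Fin.last k) : ℝ)) := fun a c q d => rfl
  rw [hdef, sum_piFinset_succ]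
  simp only [level_succ h hd, level_zero]
  refine sum_congr rfl fun u _ => ?_
  rw [hdef, mul_sum]
  refine sum_congr rfl fun x _ => ?_
  rw [← e_add, Fin.sum_univ_succ, ← add_assoc]
  have hy : (fun i : Fin (k + 1) => iv (level r (Fin.tail q) (Fin.tail d) i)
      ((Fin.cons u x : Fin (k + 1) → ℕ) i)) =
      Fin.cons (iv r u) fun i => iv (level r (Fin.tail q) (Fin.tail d) i.succ) (x i) := by
    funext i
    cases i using Fin.cases <;> simp
  rw [hy]
  simp only [← Fin.succ_last, ← Fin.succ_castSucc, Fin.cons_succ, level_succ h hd,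
    Fin.castSucc_zero, Fin.cons_zero, level_zero, Fin.tail]
  push_cast
  rfl

lemma hyperKloosterman_zero (a n : ℤ) (c : ℕ) (q d : Fin 0 → ℕ) :
    hyperKloosterman a n c q d = e ((n : ℝ) * a / c) := by
  simp [hyperKloosterman, show (Fin.last 0) = 0 from rfl]

lemma mem_divTuples_iff_tail {k b c r : ℕ} (hc : 0 < c) {q d : Fin (k + 1) → ℕ} (hq : ∀ i, 0 < q i)
    (h : d 0 * r = q 0 * c) :
    d ∈ divTuples b c q ↔ b ∣ r ∧ Fin.tail d ∈ divTuples b r (Fin.tail q) := by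
  have hpos : 0 < d 0 * r := h ▸ Nat.mul_pos (hq 0) hc
  have hd : 0 < d 0 := Nat.pos_of_mul_pos_right hpos
  rw [mem_divTuples hc hq, mem_divTuples (q := Fin.tail q) (Nat.pos_of_mul_pos_left hpos)
    (fun i => hq i.succ), Fin.forall_fin_succ, Fin.castSucc_zero, level_zero, ← h,
    Nat.mul_dvd_mul_iff_left hd]
  simp only [← Fin.succ_castSucc, level_succ h hd, Fin.tail]

lemma exists_level_one {k c : ℕ} (hc : 0 < c) {q d : Fin (k + 1) → ℕ} (hq : ∀ i, 0 < q i)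
    (h : d ∈ divTuples 1 c q) : ∃ r, 0 < r ∧ d 0 * r = q 0 * c := by
  have := (mem_divTuples hc hq).1 h 0
  rw [mul_one, Fin.castSucc_zero, level_zero] at this
  obtain ⟨r, hr⟩ := this
  exact ⟨r, Nat.pos_of_mul_pos_left (hr ▸ Nat.mul_pos (hq 0) hc : 0 < d 0 * r), hr.symm⟩

lemma hyperKloosterman_congr {k c : ℕ} [NeZero c] {a a' : ℤ} (n : ℤ) {q d : Fin k → ℕ}
    (hq : ∀ i, 0 < q i) (hd : d ∈ divTuples 1 c q) (h : (a : ZMod c) = a') :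
    hyperKloosterman a n c q d = hyperKloosterman a' n c q d := by
  have he : ∀ m : ℤ, e ((m : ℝ) * a / c) = e ((m : ℝ) * a' / c) := by
    intro m
    have h1 := e_intCast_div c (m * a)
    have h2 := e_intCast_div c (m * a')
    push_cast at h1 h2
    rw [h1, h2, h]
  cases k with
  | zero => rw [hyperKloosterman_zero, hyperKloosterman_zero, he]
  | succ k =>
    obtain ⟨r, -, hr⟩ := exists_level_one (NeZero.pos c) hq hd
    have hd0 := pos_of_mem_divTuples hd 0
    rw [hyperKloosterman_succ a n hr hd0, hyperKloosterman_succ a' n hr hd0]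
    refine sum_congr rfl fun u _ => ?_
    have := he ((d 0 * u : ℕ) : ℤ)
    rw [Int.cast_natCast] at this
    rw [this]

/-- A Gauss sum at `d u` with `u` coprime to `r = q c / d`, where `u` need not be coprime to the
modulus `c`. -/
lemma gauss_mul_coprime {b c r q d : ℕ} [NeZero c] (hbc : b ∣ c) {χ : DirichletCharacter ℂ b}
    (hχ : χ.IsPrimitive) (hd : 0 < d) (h : d * r = q * c) {u : ℕ} (hu : u.Coprime r) :
    gauss χ c ((d * u : ℕ) : ℤ) =
      if b ∣ r then χ⁻¹ (u : ZMod b) * gauss χ c (d : ℤ) else 0 := by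
  -- Only the residue of `u` modulo `c' = c / gcd(d, c)`, a divisor of `r`, matters.
  obtain ⟨f, d', c', hf, hcop, rfl, rfl⟩ := Nat.exists_coprime' (m := d) (n := c)
    (Nat.gcd_pos_of_pos_left _ hd)
  have hcr : c' ∣ r := by
    have h1 : d' * r = q * c' := by
      refine Nat.eq_of_mul_eq_mul_left hf ?_
      linear_combination h
    exact hcop.symm.dvd_of_dvd_mul_left ⟨q, by rw [h1, mul_comm]⟩
  have hc'c : c' ∣ c' * f := dvd_mul_right _ _
  obtain ⟨v, hv⟩ := ZMod.unitsMap_surjective hc'c (ZMod.unitOfCoprime u (hu.coprime_dvd_right hcr))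
  have hv' : (((v : ZMod (c' * f)).val : ℕ) : ZMod c') = (u : ZMod c') := by
    rw [← ZMod.cast_eq_val, ← ZMod.unitsMap_val hc'c, hv, ZMod.coe_unitOfCoprime]
  have hmod : (((d' * f * u : ℕ) : ℤ) : ZMod (c' * f)) =
      ((d' * f : ℕ) : ℤ) * (v : ZMod (c' * f)) := by
    rw [← ZMod.natCast_zmod_val (v : ZMod (c' * f))]
    have h1 := (ZMod.natCast_eq_natCast_iff _ _ _).1 hv'
    have h2 : d' * f * u ≡ d' * f * (v : ZMod (c' * f)).val [MOD c' * f] := by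
      have := (h1.symm.mul_right' f).mul_left d'
      simpa [mul_assoc, mul_comm, mul_left_comm] using this
    have h3 := (ZMod.natCast_eq_natCast_iff _ _ _).2 h2
    push_cast at h3 ⊢
    exact h3
  rw [gauss_mul_unit χ hbc _ v _ hmod]
  by_cases hb : b ∣ c'
  · rw [if_pos (hb.trans hcr)]
    congr 2
    rw [ZMod.natCast_eq_natCast_iff]
    exact ((ZMod.natCast_eq_natCast_iff _ _ _).1 hv').of_dvd hb
  -- The additive character then has period `c'`, which is not a multiple of the conductor.
  · have hzero : gauss χ (c' * f) ((d' * f : ℕ) : ℤ) = 0 := by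
      by_contra hne
      rw [gauss_eq_gaussSum χ hbc] at hne
      have hft := factorsThrough_of_gaussSum_ne_zero _ hc'c (by
        rw [AddChar.mulShift_mulShift]
        have : (((d' * f : ℕ) : ℤ) : ZMod (c' * f)) * (c' : ℕ) = 0 := by
          have : ((d' * (c' * f) : ℕ) : ZMod (c' * f)) = 0 := by simp
          rw [← this]
          push_cast
          ring
        rw [this, AddChar.mulShift_zero]) hne
      have hdvd := DirichletCharacter.conductor_dvd_of_mem_conductorSet _ hft
      rw [DirichletCharacter.conductor_changeLevel, hχ] at hdvd
      exact hb hdvd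
    rw [hzero, mul_zero, mul_zero, ite_self]

/-- The Fourier transform of a hyper-Kloosterman sum in the variable `a`. -/
lemma sum_char_mul_hyperKloosterman {k b c : ℕ} (hc : 0 < c) (hbc : b ∣ c)
    {χ : DirichletCharacter ℂ b} (hχ : χ.IsPrimitive) (n : ℤ) {q d : Fin k → ℕ}
    (hq : ∀ i, 0 < q i) (hd : d ∈ divTuples 1 c q) :
    ∑ a ∈ range c with a.Coprime c, χ (a : ZMod b) * hyperKloosterman a n c q d =
      if d ∈ divTuples b c q then (∏ i : Fin k, gauss χ (level c q d i.castSucc) (d i)) *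
        gauss χ (level c q d (Fin.last k)) n else 0 := by
  induction k generalizing c with
  | zero =>
    rw [if_pos ((mem_divTuples hc hq).2 fun i => i.elim0)]
    simp [hyperKloosterman_zero, gauss, show (Fin.last 0) = 0 from rfl]
  | succ k ih =>
    obtain ⟨r, hr, hrq⟩ := exists_level_one hc hq hd
    have hd0 := pos_of_mem_divTuples hd 0
    have : NeZero c := ⟨hc.ne'⟩
    have : NeZero r := ⟨hr.ne'⟩
    have hd' := ((mem_divTuples_iff_tail hc hq hrq).1 hd).2
    have h1 : ∑ a ∈ range c with a.Coprime c, χ (a : ZMod b) * hyperKloosterman a n c q d =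
        ∑ u ∈ range r with u.Coprime r, gauss χ c ((d 0 * u : ℕ) : ℤ) *
          hyperKloosterman (((u : ZMod r)⁻¹).val : ℤ) n r (Fin.tail q) (Fin.tail d) := by
      simp_rw [hyperKloosterman_succ _ n hrq hd0, mul_sum]
      rw [sum_comm]
      refine sum_congr rfl fun u _ => ?_
      rw [gauss, sum_mul]
      refine sum_congr rfl fun a _ => ?_
      rw [mul_assoc]
      push_cast
      rfl
    rw [h1, sum_congr rfl fun u hu => by
      rw [gauss_mul_coprime hbc hχ hd0 hrq (mem_filter.1 hu).2]]
    simp only [mem_divTuples_iff_tail hc hq hrq]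
    by_cases hb : b ∣ r
    · simp only [if_pos hb]
      have h2 : ∑ u ∈ range r with u.Coprime r, χ⁻¹ (u : ZMod b) *
          hyperKloosterman (((u : ZMod r)⁻¹).val : ℤ) n r (Fin.tail q) (Fin.tail d) =
          ∑ u ∈ range r with u.Coprime r, χ (u : ZMod b) *
            hyperKloosterman u n r (Fin.tail q) (Fin.tail d) := by
        rw [sum_coprime_eq_sum_units r fun u => χ⁻¹ (u : ZMod b) *
          hyperKloosterman (((u : ZMod r)⁻¹).val : ℤ) n r (Fin.tail q) (Fin.tail d),
          sum_coprime_eq_sum_units r fun u => χ (u : ZMod b) *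
            hyperKloosterman u n r (Fin.tail q) (Fin.tail d),
          ← Equiv.sum_comp (Equiv.inv (ZMod r)ˣ)]
        refine sum_congr rfl fun x _ => ?_
        rw [← changeLevel_apply_unit χ⁻¹ hb, ← changeLevel_apply_unit χ hb, map_inv,
          Equiv.inv_apply, ZMod.natCast_zmod_val, ZMod.inv_coe_unit, inv_inv, MulChar.inv_apply,
          Ring.inverse_unit, inv_inv]
      have h3 := ih hr hb (q := Fin.tail q) (fun i => hq i.succ) hd'
      calc _ = gauss χ c (d 0) * ∑ u ∈ range r with u.Coprime r, χ⁻¹ (u : ZMod b) *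
          hyperKloosterman (((u : ZMod r)⁻¹).val : ℤ) n r (Fin.tail q) (Fin.tail d) := by
            rw [mul_sum]
            exact sum_congr rfl fun u _ => by ring
        _ = _ := by
          rw [h2, h3, Fin.prod_univ_succ, Fin.castSucc_zero, level_zero, ← Fin.succ_last]
          simp only [← Fin.succ_castSucc, level_succ hrq hd0]
          rw [mul_ite, mul_zero, ← mul_assoc]
          simp only [hb, true_and]
          rfl
    · simp [hb]

/-! ### The Voronoi formula for additive twists -/

lemma char_inv_apply {c : ℕ} {χ : DirichletCharacter ℂ c} {a b : ZMod c} (h : a * b = 1) :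
    χ⁻¹ a = χ b := by
  have h1 : χ a * χ b = 1 := by rw [← map_mul, h, map_one]
  have h2 : χ⁻¹ a * χ a = 1 := by
    rw [← MulChar.mul_apply, inv_mul_cancel]
    exact MulChar.one_apply (.of_mul_eq_one _ h)
  calc χ⁻¹ a = χ⁻¹ a * (χ a * χ b) := by rw [h1, mul_one]
    _ = χ b := by rw [← mul_assoc, h2, one_mul]

lemma sum_char_inv_mul_char {c : ℕ} [NeZero c] {a a' : ZMod c} (h : a * a' = 1) (x : ZMod c) :
    ∑ χ : DirichletCharacter ℂ c, χ⁻¹ a * χ x = if a = x then (c.totient : ℂ) else 0 := by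
  rw [← DirichletCharacter.sum_char_inv_mul_char_eq ℂ (.of_mul_eq_one _ h) x]
  refine sum_congr rfl fun χ _ => ?_
  congr 1
  rw [char_inv_apply h]
  congr 1
  exact (ZMod.inv_eq_of_mul_eq_one c a a' h).symm

lemma sum_char_mul_char_inv {c : ℕ} [NeZero c] {a a' : ZMod c} (h : a * a' = 1) (x : ZMod c) :
    ∑ χ : DirichletCharacter ℂ c, χ a * χ⁻¹ x = if a = x then (c.totient : ℂ) else 0 := by
  rw [← sum_char_inv_mul_char h x, ← Equiv.sum_comp (Equiv.inv _)]
  simp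

/-- Fourier expansion over the characters modulo `c` of a function on the reduced residues. -/
lemma sum_char_transform {c : ℕ} [NeZero c] {a a' : ZMod c} (h : a * a' = 1) (f : ZMod c → ℂ) :
    ∑ χ : DirichletCharacter ℂ c, χ a' *
      ∑ u ∈ range c with u.Coprime c, χ.primitiveCharacter (u : ZMod χ.conductor) * f u =
      c.totient * f a := by
  have h1 : ∀ χ : DirichletCharacter ℂ c, χ a' *
      ∑ u ∈ range c with u.Coprime c, χ.primitiveCharacter (u : ZMod χ.conductor) * f u =
      ∑ x : ZMod c, χ⁻¹ a * χ x * f x := by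
    intro χ
    rw [sum_changeLevel _ χ.conductor_dvd_level, DirichletCharacter.changeLevel_primitiveCharacter,
      ← char_inv_apply h, mul_sum]
    exact sum_congr rfl fun x _ => (mul_assoc _ _ _).symm
  simp_rw [h1]
  rw [sum_comm]
  simp_rw [← sum_mul, sum_char_inv_mul_char h]
  simp

lemma sum_char_mul_gauss {c : ℕ} [NeZero c] {a a' : ZMod c} (h : a * a' = 1) (n : ℤ) :
    ∑ χ : DirichletCharacter ℂ c, χ a' * gauss χ.primitiveCharacter⁻¹ c n =
      c.totient * ZMod.stdAddChar ((n : ZMod c) * a') := by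
  have h1 : ∀ χ : DirichletCharacter ℂ c, χ a' * gauss χ.primitiveCharacter⁻¹ c n =
      ∑ x : ZMod c, χ a' * χ⁻¹ x * ZMod.stdAddChar ((n : ZMod c) * x) := by
    intro χ
    rw [gauss_eq_gaussSum _ χ.conductor_dvd_level, map_inv,
      DirichletCharacter.changeLevel_primitiveCharacter, gaussSum, mul_sum]
    refine sum_congr rfl fun x _ => ?_
    rw [AddChar.mulShift_apply, mul_assoc]
  simp_rw [h1]
  rw [sum_comm]
  simp_rw [← sum_mul, sum_char_mul_char_inv (mul_comm a a' ▸ h)]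
  simp

lemma gauss_neg {b c : ℕ} [NeZero c] (χ : DirichletCharacter ℂ b) (h : b ∣ c) (m : ℤ) :
    gauss χ c (-m) = χ (-1) * gauss χ c m := by
  rw [gauss_mul_unit χ h m (-1) (-m) (by push_cast; ring), ← ZMod.cast_eq_val, Units.val_neg,
    Units.val_one, ZMod.cast_neg h, ZMod.cast_one h, char_inv_apply (b := -1) (by ring)]

/-- The combination of `G₊` and `G₋` that arises from the signs `ε = ±1` in the Kloosterman sums. -/
lemma signFactor_mul {b : ℕ} (Gp Gm : ℂ → ℂ) (χ : DirichletCharacter ℂ b) (s : ℂ) :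
    signFactor Gp Gm χ s * χ (-1) = (Gp s - Gm s) / 2 + (Gp s + Gm s) / 2 * χ (-1) := by
  rcases χ.even_or_odd with h | h
  · have h : χ (-1) = 1 := h
    rw [signFactor, h, if_pos rfl]
    ring
  · have h : χ (-1) = -1 := h
    rw [signFactor, h, if_neg (by norm_num)]
    ring

lemma analyticAt_signFactor {b : ℕ} {Gp Gm : ℂ → ℂ} (χ : DirichletCharacter ℂ b) {s : ℂ}
    (hp : AnalyticAt ℂ Gp s) (hm : AnalyticAt ℂ Gm s) : AnalyticAt ℂ (signFactor Gp Gm χ) s := by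
  rw [signFactor]
  split_ifs
  exacts [hp, hm]

lemma norm_hyperKloosterman_le {k : ℕ} (c : ℕ) (q d : Fin k → ℕ) :
    ∃ K : ℝ, ∀ a n : ℤ, ‖hyperKloosterman a n c q d‖ ≤ K := by
  refine ⟨_, fun a n => (norm_sum_le _ _).trans (sum_le_sum fun x _ => (norm_e _).le)⟩

/-- Fourier expansion of a Dirichlet series with hyper-Kloosterman sums as coefficients. The factor
`η χ` is `χ(ε)`, as a function of characters of varying modulus. -/
lemma LSeries_kloostermanCoeff {k c : ℕ} [NeZero c] {A : (Fin (k + 1) → ℕ) → ℂ} {σ : ℝ}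
    (growth : ModerateGrowth A σ) {a abar : ℤ} (h : (a : ZMod c) * abar = 1) (ε : ℤ)
    {η : ∀ {b : ℕ}, DirichletCharacter ℂ b → ℂ}
    (hη : ∀ {b r : ℕ} [NeZero r] (χ : DirichletCharacter ℂ b) (_ : b ∣ r) (m : ℤ),
      gauss χ r (ε * m) = η χ * gauss χ r m)
    {q d : Fin k → ℕ} (hq : ∀ i, 0 < q i) (hd : d ∈ divTuples 1 c q) {s : ℂ} (hs : s.re < -σ) :
    c.totient * LSeries (kloostermanCoeff A a ε c q d) (1 - s) =
      ∑ χ : DirichletCharacter ℂ c, χ abar * (if d ∈ divTuples χ.conductor c q then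
        η χ.primitiveCharacter * (∏ i : Fin k, gauss χ.primitiveCharacter
          (level c q d i.castSucc) (d i)) *
          LSeries (gCoeff A q d c χ.primitiveCharacter) (1 - s) else 0) := by
  have hc := NeZero.pos c
  have hcoeff : ((c.totient : ℂ) • kloostermanCoeff A a ε c q d) =
      ∑ χ : DirichletCharacter ℂ c, (χ abar * if d ∈ divTuples χ.conductor c q then
        η χ.primitiveCharacter * (∏ i : Fin k, gauss χ.primitiveCharacter
          (level c q d i.castSucc) (d i)) else 0) • gCoeff A q d c χ.primitiveCharacter := by
    funext n
    rw [Finset.sum_apply]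
    simp only [Pi.smul_apply, smul_eq_mul, kloostermanCoeff]
    have h1 := sum_char_transform h fun x : ZMod c =>
      hyperKloosterman (x.val : ℤ) (ε * n) c q d
    have h2 : hyperKloosterman (((a : ZMod c).val : ℕ) : ℤ) (ε * n) c q d =
        hyperKloosterman a (ε * n) c q d :=
      hyperKloosterman_congr _ hq hd (by push_cast; rw [ZMod.natCast_zmod_val])
    have h3 : ∀ u : ℕ, hyperKloosterman (((u : ZMod c).val : ℕ) : ℤ) (ε * n) c q d =
        hyperKloosterman u (ε * n) c q d := fun u =>
      hyperKloosterman_congr _ hq hd (by push_cast; rw [ZMod.natCast_zmod_val])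
    simp only [h2, h3] at h1
    rw [mul_left_comm, ← h1, mul_sum]
    refine sum_congr rfl fun χ _ => ?_
    have hcond := χ.conductor_dvd_level
    have hb : 0 < χ.conductor := Nat.pos_of_dvd_of_pos hcond hc
    rw [sum_char_mul_hyperKloosterman hc hcond χ.primitiveCharacter_isPrimitive _ hq hd]
    split_ifs with hmem
    · obtain ⟨l, hl⟩ := hcond
      have hl0 : 0 < l := Nat.pos_of_mul_pos_left (hl ▸ hc)
      have hlev : χ.conductor ∣ level c q d (Fin.last k) ∧ 0 < level c q d (Fin.last k) := by
        have hmem' : d ∈ divTuples χ.conductor (χ.conductor * l) q := by rwa [← hl]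
        have := level_mul hb hl0 hq hmem' (Fin.last k)
        rw [← hl] at this
        rw [this.1]
        exact ⟨dvd_mul_right _ _, Nat.mul_pos hb this.2⟩
      have : NeZero (level c q d (Fin.last k)) := ⟨hlev.2.ne'⟩
      rw [hη _ hlev.1, gCoeff]
      ring
    · ring
  have hsum : ∀ χ : DirichletCharacter ℂ c,
      LSeriesSummable (gCoeff A q d c χ.primitiveCharacter) (1 - s) := fun χ =>
    summable_startTuple growth (pos_of_mem_divTuples hd) (fun n => norm_gauss_le _ _ n) hs
  rw [← LSeries_smul, hcoeff, LSeries_sum fun χ _ => (hsum χ).smul _]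
  refine sum_congr rfl fun χ _ => ?_
  rw [LSeries_smul]
  split_ifs <;> ring

lemma divTuples_subset {k b c : ℕ} (q : Fin k → ℕ) : divTuples b c q ⊆ divTuples 1 c q := by
  intro d hd
  rw [divTuples, mem_filter] at hd ⊢
  exact ⟨hd.1, fun i => by rw [mul_one]; exact dvd_of_mul_right_dvd (hd.2 i)⟩

/-- The right side of the additive formula as the Fourier transform of the functions `G`. -/
lemma voronoiRHS_eq {k c : ℕ} [NeZero c] {A : (Fin (k + 1) → ℕ) → ℂ} (Gp Gm : ℂ → ℂ) {σ : ℝ}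
    (growth : ModerateGrowth A σ) {a abar : ℤ} (h : (a : ZMod c) * abar = 1)
    {q : Fin k → ℕ} (hq : ∀ i, 0 < q i) {s : ℂ} (hs : s.re < -σ) :
    c.totient * voronoiRHS A Gp Gm a c q s = ∑ χ : DirichletCharacter ℂ c, χ abar *
      (((c : ℂ) / (χ.conductor : ℂ)) ^ (1 - 2 * s) *
        gSeries A Gp Gm q c χ.primitiveCharacter s) := by
  have hc : (c : ℂ) ≠ 0 := by exact_mod_cast NeZero.ne c
  have hsum : ∀ (ε : ℤ) (η : ∀ {b : ℕ}, DirichletCharacter ℂ b → ℂ)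
      (_ : ∀ {b r : ℕ} [NeZero r] (χ : DirichletCharacter ℂ b) (_ : b ∣ r) (m : ℤ),
        gauss χ r (ε * m) = η χ * gauss χ r m),
      c.totient * ∑ d ∈ divTuples 1 c q,
        LSeries (kloostermanCoeff A a ε c q d) (1 - s) * weight c q d s =
      ∑ χ : DirichletCharacter ℂ c, χ abar * (η χ.primitiveCharacter *
        ∑ d ∈ divTuples 1 c q, if d ∈ divTuples χ.conductor c q then
          (∏ i : Fin k, gauss χ.primitiveCharacter (level c q d i.castSucc) (d i)) *
            LSeries (gCoeff A q d c χ.primitiveCharacter) (1 - s) * weight c q d s else 0) := by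
    intro ε η hη
    simp_rw [mul_sum]
    rw [sum_comm]
    refine sum_congr rfl fun d hd => ?_
    rw [← mul_assoc, LSeries_kloostermanCoeff growth h ε (η := η) hη hq hd hs, sum_mul]
    refine sum_congr rfl fun χ _ => ?_
    split_ifs <;> ring
  have hG : ∀ χ : DirichletCharacter ℂ c, ((c : ℂ) / (χ.conductor : ℂ)) ^ (1 - 2 * s) *
      gSeries A Gp Gm q c χ.primitiveCharacter s =
      signFactor Gp Gm χ.primitiveCharacter s * χ.primitiveCharacter (-1) *
      ∑ d ∈ divTuples 1 c q, if d ∈ divTuples χ.conductor c q then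
        (∏ i : Fin k, gauss χ.primitiveCharacter (level c q d i.castSucc) (d i)) *
          LSeries (gCoeff A q d c χ.primitiveCharacter) (1 - s) * weight c q d s else 0 := by
    intro χ
    have hb : (χ.conductor : ℂ) ≠ 0 := by exact_mod_cast χ.conductor_ne_zero
    have hne : ((c : ℂ) / (χ.conductor : ℂ)) ^ (1 - 2 * s) ≠ 0 := by
      rw [Ne, Complex.cpow_eq_zero_iff]
      exact fun h0 => div_ne_zero hc hb h0.1
    rw [gSeries, ← mul_assoc, mul_div_cancel₀ _ hne, ← sum_filter, filter_mem_eq_inter,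
      inter_eq_right.2 (divTuples_subset q)]
    congr 1
    exact sum_congr rfl fun d _ => by ring
  simp_rw [hG, signFactor_mul]
  rw [voronoiRHS, mul_add, mul_left_comm, mul_left_comm (c.totient : ℂ),
    hsum 1 (fun _ => 1) (by simp), hsum (-1) (fun χ => χ (-1))
      (fun χ hb m => by rw [neg_one_mul, gauss_neg χ hb]), mul_sum, mul_sum, ← sum_add_distrib]
  exact sum_congr rfl fun χ _ => by ring

/-- The Voronoi formula for additive twists. -/
theorem voronoi_additive {k : ℕ} {A : (Fin (k + 1) → ℕ) → ℂ} {Gp Gm : ℂ → ℂ} {σ : ℝ}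
    (hecke : HeckeRelations A) (growth : ModerateGrowth A σ)
    (hFE : TwistedFunctionalEquations A Gp Gm σ) (c : ℕ) (a abar : ℤ) (q : Fin k → ℕ)
    (hc : 0 < c) (ha : a * abar ≡ 1 [ZMOD c]) (hq : ∀ i, 0 < q i) :
    ∃ L : ℂ → ℂ, Differentiable ℂ L ∧
      (∀ s : ℂ, 1 + σ < s.re →
        LSeriesSummable (additiveCoeff A q c abar) s ∧ L s = LSeries (additiveCoeff A q c abar) s) ∧
      (∀ s : ℂ, s.re < -σ →
        (∀ d ∈ divTuples 1 c q,
          LSeriesSummable (kloostermanCoeff A a 1 c q d) (1 - s) ∧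
          LSeriesSummable (kloostermanCoeff A a (-1) c q d) (1 - s)) ∧
        (AnalyticAt ℂ Gp s → AnalyticAt ℂ Gm s → L s = voronoiRHS A Gp Gm a c q s)) := by
  have : NeZero c := ⟨hc.ne'⟩
  have hc' : (c : ℂ) ≠ 0 := by exact_mod_cast hc.ne'
  have hφ : (c.totient : ℂ) ≠ 0 := by exact_mod_cast (Nat.totient_pos.2 hc).ne'
  have hinv : (a : ZMod c) * abar = 1 := by
    have := (ZMod.intCast_eq_intCast_iff _ _ _).2 ha
    simpa using this
  have hb : ∀ χ : DirichletCharacter ℂ c, (c : ℂ) / (χ.conductor : ℂ) ≠ 0 := fun χ =>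
    div_ne_zero hc' (by exact_mod_cast χ.conductor_ne_zero)
  have hb' : ∀ (χ : DirichletCharacter ℂ c) (s : ℂ),
      ((c : ℂ) / (χ.conductor : ℂ)) ^ (1 - 2 * s) ≠ 0 := fun χ s => by
    rw [Ne, Complex.cpow_eq_zero_iff]
    exact fun h0 => hb χ h0.1
  choose E hE hE1 hE2 using fun χ : DirichletCharacter ℂ c =>
    voronoi_gauss hecke growth hFE χ.conductor c χ.primitiveCharacter q hc χ.conductor_dvd_level
      χ.primitiveCharacter_isPrimitive hq
  refine ⟨fun s => (c.totient : ℂ)⁻¹ * ∑ χ : DirichletCharacter ℂ c, χ abar *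
    (((c : ℂ) / (χ.conductor : ℂ)) ^ (1 - 2 * s) * E χ s), ?_, fun s hs => ⟨?_, ?_⟩,
    fun s hs => ⟨fun d hd => ?_, fun hGp hGm => ?_⟩⟩
  · refine (differentiable_const _).mul (Differentiable.fun_sum fun χ _ =>
      (differentiable_const _).mul (Differentiable.mul (fun s => ?_) (hE χ)))
    exact DifferentiableAt.const_cpow (by fun_prop) (Or.inl (hb χ))
  · exact summable_endTuple growth hq (fun n => (norm_e _).le) hs
  · have hcoeff : additiveCoeff A q c abar = (c.totient : ℂ)⁻¹ •
        ∑ χ : DirichletCharacter ℂ c, χ abar • hCoeff A q c χ.primitiveCharacter := by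
      funext n
      rw [Pi.smul_apply, Finset.sum_apply]
      simp only [Pi.smul_apply, smul_eq_mul, hCoeff, additiveCoeff]
      simp_rw [mul_left_comm _ (A _)]
      rw [← mul_sum, sum_char_mul_gauss hinv]
      have := e_intCast_div c (abar * n)
      push_cast at this
      rw [this, mul_left_comm, inv_mul_cancel_left₀ hφ, Int.cast_natCast, mul_comm (n : ZMod c)]
    rw [hcoeff, LSeries_smul, LSeries_sum fun χ _ => LSeriesSummable.smul _ (hE1 χ s hs).1]
    beta_reduce
    congr 1
    refine sum_congr rfl fun χ _ => ?_
    rw [LSeries_smul, (hE1 χ s hs).2, hSeries, mul_div_cancel₀ _ (hb' χ s)]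
  · obtain ⟨K, hK⟩ := norm_hyperKloosterman_le c q d
    have hd0 := pos_of_mem_divTuples hd
    exact ⟨summable_startTuple growth hd0 (fun n => hK a _) hs,
      summable_startTuple growth hd0 (fun n => hK a _) hs⟩
  · beta_reduce
    rw [inv_mul_eq_iff_eq_mul₀ hφ, voronoiRHS_eq Gp Gm growth hinv hq hs]
    refine sum_congr rfl fun χ _ => ?_
    rw [(hE2 χ s hs).2 (analyticAt_signFactor _ hGp hGm)]

end Voronoi

theorem theorem1p3 (k : ℕ) (A : (Fin (k + 1) → ℕ) → ℂ) (Gp Gm : ℂ → ℂ) (σ : ℝ)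
    (hσ : 0 < σ) (hA1 : A (fun _ => 1) = 1) (hecke : Voronoi.HeckeRelations A)
    (growth : Voronoi.ModerateGrowth A σ)
    (hGp : MeromorphicOn Gp Set.univ) (hGm : MeromorphicOn Gm Set.univ)
    (hFE : Voronoi.TwistedFunctionalEquations A Gp Gm σ) :
    -- the Voronoi formula for the additively twisted series `L_q(s, F, a/c)`
    (∀ (c : ℕ) (a abar : ℤ) (q : Fin k → ℕ), 0 < c → a * abar ≡ 1 [ZMOD c] →
      (∀ i, 0 < q i) →
      ∃ L : ℂ → ℂ, Differentiable ℂ L ∧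
        (∀ s : ℂ, 1 + σ < s.re →
          LSeriesSummable (Voronoi.additiveCoeff A q c abar) s ∧
          L s = LSeries (Voronoi.additiveCoeff A q c abar) s) ∧
        (∀ s : ℂ, s.re < -σ →
          (∀ d ∈ Voronoi.divTuples 1 c q,
            LSeriesSummable (Voronoi.kloostermanCoeff A a 1 c q d) (1 - s) ∧
            LSeriesSummable (Voronoi.kloostermanCoeff A a (-1) c q d) (1 - s)) ∧
          (AnalyticAt ℂ Gp s → AnalyticAt ℂ Gm s →
            L s = Voronoi.voronoiRHS A Gp Gm a c q s))) ∧
    -- the Voronoi formula with Gauss sums, `H(q; c, χ*, s) = G(q; c, χ*, s)`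
    (∀ (cstar c : ℕ) (χ : DirichletCharacter ℂ cstar) (q : Fin k → ℕ), 0 < c →
      cstar ∣ c → χ.IsPrimitive → (∀ i, 0 < q i) →
      ∃ E : ℂ → ℂ, Differentiable ℂ E ∧
        (∀ s : ℂ, 1 + σ < s.re →
          LSeriesSummable (Voronoi.hCoeff A q c χ) s ∧
          E s = Voronoi.hSeries A q c χ s) ∧
        (∀ s : ℂ, s.re < -σ →
          (∀ d ∈ Voronoi.divTuples cstar c q,
            LSeriesSummable (Voronoi.gCoeff A q d c χ) (1 - s)) ∧
          (AnalyticAt ℂ (Voronoi.signFactor Gp Gm χ) s →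
            E s = Voronoi.gSeries A Gp Gm q c χ s))) := by
  exact ⟨fun c a abar q => Voronoi.voronoi_additive hecke growth hFE c a abar q,
    fun cstar c χ q => Voronoi.voronoi_gauss hecke growth hFE cstar c χ q⟩
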